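/- Let $d\ge 1$ be square-free and $q=e^{2\pi i/d}$. Let $PF_\infty$ be the unital $*$-algebra over $\mathbb C$ generated by $c_1,c_2,\dots$ with $c_jc_k=q\,c_kc_j$ for $j<k$, $c_j^d=1$ and $c_j^*=c_j^{-1}$; it is $\mathbb Z_d$-graded by the charge, where every $c_j$ has charge $1$. Let $PF_2$ be the algebra generated in the same way by $c_1,c_2$, and let $\alpha$ be the $*$-endomorphism $c_j\mapsto c_{j+2}$ of $PF_\infty$. Put $s_k=d^{-1/2}\sum_{i=0}^{d-1}c_{k+1}^{-i}c_k^{\,i}$ (a unitary, the braid of the strings $k,k+1$ up to a phase) and let $\mathbb B_\infty$ be the group generated by the four-string braids $b_j=s_{2j}s_{2j-1}s_{2j+1}s_{2j}$, $j\ge 1$. Let $S_{\mathbb B_\infty}$ be the set of states $\varphi$ on $PF_\infty$ with $\varphi(bxb^{*})=\varphi(x)$ for all $b\in\mathbb B_\infty$ and $x\in PF_\infty$. For $\varphi\in S_{\mathbb B_\infty}$ let $(H,\pi,\Omega)$ be its GNS representation and $M=\pi(PF_\infty)''$. Define the tail algebra $PF^T=\bigcap_{n}\alpha^n(M)$, where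 $\alpha^n(M)$ is the von Neumann algebra $\pi(\alpha^n(PF_\infty))''$; let its neutral part $PF^{T,0}$ be the intersection of $PF^T$ with the von Neumann algebra generated by $\pi(x)$, $x\in PF_\infty$ of charge $0$; and let $M^{\mathbb B_\infty}=\{X\in M:\ \pi(b)X\pi(b)^{*}=X\ \text{for all } b\in\mathbb B_\infty\}$. Then for every $\varphi\in S_{\mathbb B_\infty}$ the following are equivalent: 1. $\varphi$ is an extreme point of $S_{\mathbb B_\infty}$; 2. $\varphi=\rho^{\otimes\infty}$ for some neutral state $\rho$ on $PF_2$, that is, a state that vanishes on the elements of non-zero charge and satisfies $\varphi(x_1\,\alpha(x_2)\cdots\alpha^{n-1}(x_n))=\prod_{k=1}^n\rho(x_k)$ for all $n$ and all $x_1,\dots,x_n\in PF_2$; 3. $PF^{T,0}=\mathbb C$; 4. $PF^{T}=\mathbb C$; 5. $M$ is a factor. Moreover $PF^T\subseteq M^{\mathbb B_\infty}$, and $PF^T=M^{\mathbb B_\infty}$ whenever $\Omega$ is separating for $M$ (that is, whenever the normal extension of $\varphi$ to $M$ is faithful). -/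

import Mathlib

open scoped ComplexOrder InnerProductSpace
open UniformSpace

noncomputable section

/-! ### Parafermion algebras

`PF d ι` is the unital `*`-algebra over `ℂ` generated by unitaries `c j` (`j ∈ ι`, a linear order)
with `c j ^ d = 1` and `c j * c k = q • (c k * c j)` for `j < k`, where `q = exp (2 π i / d)`.
It is realised on its basis of ordered monomials `∏ c j ^ a j` (increasing `j` from left to right),
indexed by the finitely supported exponents `a : ι →₀ ZMod d`.
`PF d ℕ` is `PF_∞` and `PF d (Fin 2)` is `PF_2`; strings are numbered from `0`. -/

/-- `∑_{k < j} a j * b k`: moving the monomial of exponent `b` into place through the monomial of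
exponent `a` produces the phase `q ^ (- cross a b)`. -/
def cross {d : ℕ} {ι : Type*} [LinearOrder ι] (a b : ι →₀ ZMod d) : ZMod d :=
  a.sum fun j s => b.sum fun k t => if k < j then s * t else 0

theorem cross_add_left {d : ℕ} {ι : Type*} [LinearOrder ι] (a a' b : ι →₀ ZMod d) :
    cross (a + a') b = cross a b + cross a' b := by
  unfold cross
  apply Finsupp.sum_add_index'
  · intro j; simp
  · intro j s s'
    rw [← Finsupp.sum_add]
    refine Finsupp.sum_congr fun k _ => ?_
    split_ifs <;> ring

theorem cross_add_right {d : ℕ} {ι : Type*} [LinearOrder ι] (a b b' : ι →₀ ZMod d) :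
    cross a (b + b') = cross a b + cross a b' := by
  unfold cross
  rw [← Finsupp.sum_add]
  refine Finsupp.sum_congr fun j _ => ?_
  apply Finsupp.sum_add_index'
  · intro k; simp
  · intro k t t'
    split_ifs <;> ring

@[simp] theorem cross_zero_left {d : ℕ} {ι : Type*} [LinearOrder ι] (b : ι →₀ ZMod d) :
    cross 0 b = 0 := by
  have h := cross_add_left 0 0 b
  simpa using h

@[simp] theorem cross_zero_right {d : ℕ} {ι : Type*} [LinearOrder ι] (a : ι →₀ ZMod d) :
    cross a 0 = 0 := by
  have h := cross_add_right a 0 0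
  simpa using h

@[simp] theorem cross_neg_left {d : ℕ} {ι : Type*} [LinearOrder ι] (a b : ι →₀ ZMod d) :
    cross (-a) b = - cross a b := by
  have h := cross_add_left a (-a) b
  rw [add_neg_cancel, cross_zero_left] at h
  exact eq_neg_of_add_eq_zero_right h.symm

@[simp] theorem cross_neg_right {d : ℕ} {ι : Type*} [LinearOrder ι] (a b : ι →₀ ZMod d) :
    cross a (-b) = - cross a b := by
  have h := cross_add_right a b (-b)
  rw [add_neg_cancel, cross_zero_right] at h
  exact eq_neg_of_add_eq_zero_right h.symm

theorem cross_single {d : ℕ} {ι : Type*} [LinearOrder ι] (j k : ι) (s t : ZMod d) :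
    cross (Finsupp.single j s) (Finsupp.single k t) = if k < j then s * t else 0 := by
  unfold cross
  rw [Finsupp.sum_single_index, Finsupp.sum_single_index] <;> simp

theorem cross_mapDomain {d : ℕ} {ι κ : Type*} [LinearOrder ι] [LinearOrder κ] (f : ι ↪o κ)
    (a b : ι →₀ ZMod d) : cross (a.mapDomain f) (b.mapDomain f) = cross a b := by
  induction a using Finsupp.induction_linear with
  | zero => simp
  | add a a' h h' => rw [Finsupp.mapDomain_add, cross_add_left, cross_add_left, h, h']
  | single j s =>
    induction b using Finsupp.induction_linear with
    | zero => simp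
    | add b b' h h' => rw [Finsupp.mapDomain_add, cross_add_right, cross_add_right, h, h']
    | single k t =>
      simp only [Finsupp.mapDomain_single, cross_single, f.lt_iff_lt]

/-- The character `k ↦ q ^ k = exp (2 π i k / d)` of `ℤ/d`. -/
def qpow {d : ℕ} [NeZero d] (k : ZMod d) : ℂ := ZMod.stdAddChar k

theorem qpow_add {d : ℕ} [NeZero d] (k l : ZMod d) : qpow (k + l) = qpow k * qpow l :=
  AddChar.map_add_eq_mul _ _ _

@[simp] theorem qpow_zero {d : ℕ} [NeZero d] : qpow (0 : ZMod d) = 1 :=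
  AddChar.map_zero_eq_one _

theorem qpow_neg {d : ℕ} [NeZero d] (k : ZMod d) : qpow (-k) = star (qpow k) := by
  unfold qpow
  rw [AddChar.map_neg_eq_conj]
  rfl

theorem qpow_one {d : ℕ} [NeZero d] :
    qpow (1 : ZMod d) = Complex.exp (2 * Real.pi * Complex.I / d) := by
  have h := ZMod.stdAddChar_coe (N := d) 1
  unfold qpow
  simpa using h

/-- The parafermion algebra of order `d` on the strings `ι`, as a vector space with basis the
ordered monomials. -/
def PF (d : ℕ) (ι : Type*) : Type _ := (ι →₀ ZMod d) →₀ ℂ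

namespace PF

section Algebra

variable {d : ℕ} {ι : Type*}

instance : AddCommGroup (PF d ι) := inferInstanceAs (AddCommGroup ((ι →₀ ZMod d) →₀ ℂ))
instance : Module ℂ (PF d ι) := inferInstanceAs (Module ℂ ((ι →₀ ZMod d) →₀ ℂ))

/-- The multiple `s` of the ordered monomial `∏ c j ^ a j`. -/
def mono (a : ι →₀ ZMod d) (s : ℂ) : PF d ι := Finsupp.single a s

/-- The linear map sending each ordered monomial of exponent `a` to `v a`. -/
def ofBasis {M : Type*} [AddCommGroup M] [Module ℂ M] (v : (ι →₀ ZMod d) → M) : PF d ι →ₗ[ℂ] M :=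
  Finsupp.linearCombination ℂ v

theorem ofBasis_mono {M : Type*} [AddCommGroup M] [Module ℂ M] (v : (ι →₀ ZMod d) → M)
    (a : ι →₀ ZMod d) (s : ℂ) : ofBasis v (mono a s) = s • v a :=
  Finsupp.linearCombination_single ℂ s a

theorem smul_mono (r : ℂ) (a : ι →₀ ZMod d) (s : ℂ) : r • mono a s = mono a (r * s) :=
  Finsupp.smul_single r a s

theorem mono_add (a : ι →₀ ZMod d) (s t : ℂ) : mono a (s + t) = mono a s + mono a t :=
  Finsupp.single_add a s t

theorem induction_mono {p : PF d ι → Prop} (x : PF d ι) (zero : p 0)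
    (add : ∀ x y, p x → p y → p (x + y)) (mono : ∀ a s, p (mono a s)) : p x :=
  Finsupp.induction_linear (motive := p) x zero add mono

theorem mono_zero (a : ι →₀ ZMod d) : (mono a 0 : PF d ι) = 0 := Finsupp.single_zero a

instance : One (PF d ι) := ⟨mono 0 1⟩

theorem one_def : (1 : PF d ι) = mono 0 1 := rfl

variable [NeZero d] [LinearOrder ι]

/-- The product, as a bilinear map: the monomials of exponents `a`, `b` multiply to
`q ^ (- cross a b)` times the monomial of exponent `a + b`. -/
def mulBilin : PF d ι →ₗ[ℂ] PF d ι →ₗ[ℂ] PF d ι :=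
  ofBasis fun a => ofBasis fun b => mono (a + b) (qpow (- cross a b))

instance : Mul (PF d ι) := ⟨fun x y => mulBilin x y⟩

theorem mul_def (x y : PF d ι) : x * y = mulBilin x y := rfl

theorem mono_mul_mono (a b : ι →₀ ZMod d) (s t : ℂ) :
    (mono a s * mono b t : PF d ι) = mono (a + b) (s * t * qpow (- cross a b)) := by
  rw [mul_def, mulBilin, ofBasis_mono, LinearMap.smul_apply, ofBasis_mono, smul_mono, smul_mono,
    mul_assoc]

theorem add_mul' (x y z : PF d ι) : (x + y) * z = x * z + y * z := by
  simp only [mul_def, map_add, LinearMap.add_apply]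

theorem mul_add' (x y z : PF d ι) : x * (y + z) = x * y + x * z := by
  simp only [mul_def, map_add]

theorem zero_mul' (x : PF d ι) : 0 * x = 0 := by
  simp only [mul_def, map_zero, LinearMap.zero_apply]

theorem mul_zero' (x : PF d ι) : x * 0 = 0 := by
  simp only [mul_def, map_zero]

theorem mul_assoc' (x y z : PF d ι) : x * y * z = x * (y * z) := by
  induction x using induction_mono with
  | zero => simp only [zero_mul']
  | add x x' h h' => simp only [add_mul', h, h']
  | mono a s =>
    induction y using induction_mono with
    | zero => simp only [zero_mul', mul_zero']
    | add y y' h h' => simp only [add_mul', mul_add', h, h']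
    | mono b t =>
      induction z using induction_mono with
      | zero => simp only [mul_zero']
      | add z z' h h' => simp only [mul_add', h, h']
      | mono e u =>
        simp only [mono_mul_mono, cross_add_left, cross_add_right, neg_add, qpow_add, add_assoc]
        congr 1
        ring

theorem one_mul' (x : PF d ι) : 1 * x = x := by
  induction x using induction_mono with
  | zero => exact mul_zero' _
  | add x y h h' => rw [mul_add', h, h']
  | mono a s => rw [one_def, mono_mul_mono]; simp

theorem mul_one' (x : PF d ι) : x * 1 = x := by
  induction x using induction_mono with
  | zero => exact zero_mul' _
  | add x y h h' => rw [add_mul', h, h']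
  | mono a s => rw [one_def, mono_mul_mono]; simp

instance : Ring (PF d ι) where
  left_distrib := mul_add'
  right_distrib := add_mul'
  zero_mul := zero_mul'
  mul_zero := mul_zero'
  mul_assoc := mul_assoc'
  one_mul := one_mul'
  mul_one := mul_one'
  __ := (inferInstance : AddCommGroup (PF d ι))

instance : Algebra ℂ (PF d ι) :=
  Algebra.ofModule
    (fun r x y => by simp only [mul_def, map_smul, LinearMap.smul_apply])
    (fun r x y => by simp only [mul_def, map_smul])

/-- The adjoint: conjugate-linear, sending each monomial to its inverse. -/
instance : Star (PF d ι) :=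
  ⟨fun x => Finsupp.sum x fun a s => mono (-a) (star s * qpow (- cross a a))⟩

theorem star_mono (a : ι →₀ ZMod d) (s : ℂ) :
    star (mono a s : PF d ι) = mono (-a) (star s * qpow (- cross a a)) := by
  change Finsupp.sum (Finsupp.single a s) _ = _
  rw [Finsupp.sum_single_index]
  rw [star_zero, zero_mul, mono_zero]

theorem star_zero' : star (0 : PF d ι) = 0 := Finsupp.sum_zero_index

theorem star_add' (x y : PF d ι) : star (x + y) = star x + star y := by
  change Finsupp.sum (_ + _) _ = Finsupp.sum _ _ + Finsupp.sum _ _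
  apply Finsupp.sum_add_index'
  · intro a; rw [star_zero, zero_mul, mono_zero]
  · intro a s t
    rw [star_add, add_mul, mono_add]

instance : StarRing (PF d ι) where
  star_add := star_add'
  star_involutive x := by
    induction x using induction_mono with
    | zero => rw [star_zero', star_zero']
    | add x y h h' => rw [star_add', star_add', h, h']
    | mono a s =>
      rw [star_mono, star_mono]
      simp only [neg_neg, cross_neg_left, cross_neg_right, star_mul', star_star, qpow_neg]
      congr 1
      rw [mul_assoc, ← qpow_neg, ← qpow_add]
      simp
  star_mul x y := by
    induction x using induction_mono with
    | zero => rw [zero_mul, star_zero', mul_zero]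
    | add x x' h h' => rw [add_mul, star_add', star_add', h, h', mul_add]
    | mono a s =>
      induction y using induction_mono with
      | zero => rw [mul_zero, star_zero', zero_mul]
      | add y y' h h' => rw [mul_add, star_add', star_add', h, h', add_mul]
      | mono b t =>
        simp only [star_mono, mono_mul_mono, star_mul', ← qpow_neg, neg_neg, cross_neg_left,
          cross_neg_right, cross_add_left, cross_add_right, neg_add_rev]
        congr 1
        have h : ∀ u v w z : ZMod d,
            qpow u * qpow (-z + -u + (-v + -w)) = qpow (-z) * qpow (-w) * qpow (-v) := by
          intro u v w z
          simp only [← qpow_add]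
          congr 1
          ring
        have h' := h (cross a b) (cross b a) (cross a a) (cross b b)
        linear_combination (star s * star t) * h'

instance : StarModule ℂ (PF d ι) where
  star_smul r x := by
    induction x using induction_mono with
    | zero => simp
    | add x y h h' => rw [smul_add, star_add, star_add, h, h', smul_add]
    | mono a s => rw [smul_mono, star_mono, star_mono, smul_mono, star_mul', mul_assoc]

/-- The parafermion generator on string `j`. -/
def c (j : ι) : PF d ι := mono (Finsupp.single j 1) 1

/-- The elements of charge `k`: the span of the monomials of total degree `k` modulo `d`. -/
def charge (k : ZMod d) : Submodule ℂ (PF d ι) :=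
  Submodule.span ℂ {x | ∃ a : ι →₀ ZMod d, (a.sum fun _ s => s) = k ∧ x = mono a 1}

theorem c_pow (j : ι) (n : ℕ) : (c j : PF d ι) ^ n = mono (Finsupp.single j (n : ZMod d)) 1 := by
  induction n with
  | zero => simp [one_def]
  | succ n ih =>
    rw [pow_succ, ih, c, mono_mul_mono, ← Finsupp.single_add, cross_single]
    simp

theorem c_pow_card (j : ι) : (c j : PF d ι) ^ d = 1 := by
  rw [c_pow]
  simp [one_def]

theorem c_mul_c {j k : ι} (h : j < k) :
    (c j * c k : PF d ι) = Complex.exp (2 * Real.pi * Complex.I / d) • (c k * c j) := by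
  rw [c, c, mono_mul_mono, mono_mul_mono, cross_single, cross_single, smul_mono, ← qpow_one,
    if_neg h.not_gt, if_pos h, add_comm]
  simp [← qpow_add]

theorem star_mono_mul_mono (a : ι →₀ ZMod d) : star (mono a 1 : PF d ι) * mono a 1 = 1 := by
  rw [star_mono, mono_mul_mono, one_def]
  simp [← qpow_add]

theorem mono_mul_star_mono (a : ι →₀ ZMod d) : (mono a 1 : PF d ι) * star (mono a 1) = 1 := by
  rw [star_mono, mono_mul_mono, one_def]
  simp [← qpow_add]

theorem star_c_mul_c (j : ι) : star (c j : PF d ι) * c j = 1 := star_mono_mul_mono _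
theorem c_mul_star_c (j : ι) : (c j : PF d ι) * star (c j) = 1 := mono_mul_star_mono _

/-- The `*`-homomorphism `c j ↦ c (f j)` given by an order embedding `f` of the strings. -/
def map {κ : Type*} [LinearOrder κ] (f : ι ↪o κ) : PF d ι →⋆ₐ[ℂ] PF d κ where
  toAlgHom := AlgHom.ofLinearMap (ofBasis fun a => mono (a.mapDomain f) 1)
    (by rw [one_def, ofBasis_mono, Finsupp.mapDomain_zero, one_smul, one_def])
    (fun x y => by
      induction x using induction_mono with
      | zero => simp
      | add x x' h h' => rw [add_mul, map_add, map_add, h, h', add_mul]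
      | mono a s =>
        induction y using induction_mono with
        | zero => simp
        | add y y' h h' => rw [mul_add, map_add, map_add, h, h', mul_add]
        | mono b t =>
          simp only [mono_mul_mono, ofBasis_mono, smul_mono, Finsupp.mapDomain_add,
            cross_mapDomain, mul_one])
  map_star' x := by
    change ofBasis _ (star x) = star (ofBasis _ x)
    induction x using induction_mono with
    | zero => simp
    | add x x' h h' => rw [star_add, map_add, map_add, h, h', star_add]
    | mono a s =>
      simp only [star_mono, ofBasis_mono, smul_mono, cross_mapDomain, mul_one]
      congr 1
      exact map_neg (Finsupp.mapDomain.addMonoidHom f) a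

theorem map_c {κ : Type*} [LinearOrder κ] (f : ι ↪o κ) (j : ι) :
    map f (c j : PF d ι) = (c (f j) : PF d κ) := by
  change ofBasis _ (mono _ _) = _
  rw [ofBasis_mono, Finsupp.mapDomain_single, one_smul, c]

theorem mono_mem_adjoin (a : ι →₀ ZMod d) :
    (mono a 1 : PF d ι) ∈ StarAlgebra.adjoin ℂ (Set.range (c : ι → PF d ι)) := by
  induction a using Finsupp.induction_linear with
  | zero => exact one_mem _
  | add a b ha hb =>
    have h : (mono (a + b) 1 : PF d ι) = qpow (cross a b) • (mono a 1 * mono b 1) := by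
      rw [mono_mul_mono, smul_mono]
      simp [← qpow_add]
    rw [h]
    exact SMulMemClass.smul_mem _ (mul_mem ha hb)
  | single j s =>
    rw [← ZMod.natCast_zmod_val s, ← c_pow]
    exact pow_mem (StarAlgebra.subset_adjoin ℂ _ (Set.mem_range_self j)) _

/-- The parafermions generate the algebra. -/
theorem adjoin_range_c : StarAlgebra.adjoin ℂ (Set.range (c : ι → PF d ι)) = ⊤ := by
  refine eq_top_iff.2 fun x _ => ?_
  induction x using induction_mono with
  | zero => exact zero_mem _
  | add x y h h' => exact add_mem (h trivial) (h' trivial)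
  | mono a s =>
    rw [← mul_one s, ← smul_mono]
    exact SMulMemClass.smul_mem _ (mono_mem_adjoin a)

end Algebra

end PF

/-! ### The four-string braid group -/

section Braid

theorem cross_pair (d : ℕ) (k : ℕ) (i j : ZMod d) :
    cross (Finsupp.single k i - Finsupp.single (k + 1) i)
      (Finsupp.single k j - Finsupp.single (k + 1) j) = - (i * j) := by
  simp [sub_eq_add_neg, cross_add_left, cross_add_right, cross_single]

variable (d : ℕ) [NeZero d]

/-- The double shift `c j ↦ c (j + 2)` of `PF_∞`. -/
def doubleShift : PF d ℕ →⋆ₐ[ℂ] PF d ℕ :=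
  PF.map (OrderEmbedding.ofStrictMono (fun j => j + 2) fun _ _ h => Nat.add_lt_add_right h 2)

/-- The inclusion of `PF_2` in `PF_∞` on the `k`-th pair of strings:
`c 0 ↦ c (2 * k)`, `c 1 ↦ c (2 * k + 1)`. -/
def pairIncl (k : ℕ) : PF d (Fin 2) →⋆ₐ[ℂ] PF d ℕ :=
  PF.map (OrderEmbedding.ofStrictMono (fun i => 2 * k + (i : ℕ))
    fun _ _ h => Nat.add_lt_add_left h (2 * k))

/-- The braid of the strings `k` and `k + 1`, normalised to be unitary up to an irrelevant phase
factor (which would cancel in its adjoint action). -/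
def twoStringBraid (k : ℕ) : PF d ℕ :=
  ((√(d : ℝ) : ℝ) : ℂ)⁻¹ •
    ∑ i : ZMod d, star (PF.c (k + 1)) ^ i.val * (PF.c k : PF d ℕ) ^ i.val

theorem twoStringBraid_eq (k : ℕ) : twoStringBraid d k =
    ((√(d : ℝ) : ℝ) : ℂ)⁻¹ • ∑ i : ZMod d,
      PF.mono (Finsupp.single k i - Finsupp.single (k + 1) i) (qpow (i * i)) := by
  unfold twoStringBraid
  congr 1
  refine Finset.sum_congr rfl fun i _ => ?_
  rw [← star_pow, PF.c_pow, PF.c_pow, PF.star_mono, PF.mono_mul_mono, ZMod.natCast_zmod_val,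
    cross_neg_left, cross_single, cross_single, sub_eq_neg_add]
  simp

theorem star_twoStringBraid_eq (k : ℕ) : star (twoStringBraid d k) =
    ((√(d : ℝ) : ℝ) : ℂ)⁻¹ • ∑ i : ZMod d,
      PF.mono (-(Finsupp.single k i - Finsupp.single (k + 1) i)) 1 := by
  rw [twoStringBraid_eq, star_smul, star_sum]
  congr 1
  · simp
  · refine Finset.sum_congr rfl fun i _ => ?_
    rw [PF.star_mono, cross_pair, ← qpow_neg, ← qpow_add]
    simp

theorem sum_qpow (r : ZMod d) : ∑ x : ZMod d, qpow (x * r) = if r = 0 then (d : ℂ) else 0 := by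
  have h := AddChar.sum_mulShift r (ZMod.isPrimitive_stdAddChar d)
  rw [ZMod.card] at h
  unfold qpow
  rw [h]
  split_ifs <;> simp

theorem sum_pair (k : ℕ) :
    ∑ l : ZMod d, ∑ i : ZMod d, (PF.mono (Finsupp.single k (i - l) - Finsupp.single (k + 1) (i - l))
      (qpow (i * (i - l))) : PF d ℕ) = PF.mono 0 d := by
  rw [Finset.sum_comm]
  have h : ∀ i : ZMod d, ∑ l : ZMod d,
      (PF.mono (Finsupp.single k (i - l) - Finsupp.single (k + 1) (i - l))
        (qpow (i * (i - l))) : PF d ℕ) =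
      ∑ r : ZMod d, PF.mono (Finsupp.single k r - Finsupp.single (k + 1) r) (qpow (i * r)) :=
    fun i => Fintype.sum_equiv (Equiv.subLeft i) _ _ fun l => rfl
  simp only [h]
  rw [Finset.sum_comm]
  have h2 : ∀ r : ZMod d, ∑ i : ZMod d,
      (PF.mono (Finsupp.single k r - Finsupp.single (k + 1) r) (qpow (i * r)) : PF d ℕ) =
      PF.mono (Finsupp.single k r - Finsupp.single (k + 1) r) (if r = 0 then (d : ℂ) else 0) := by
    intro r
    rw [← sum_qpow]
    exact (map_sum (Finsupp.singleAddHom (Finsupp.single k r - Finsupp.single (k + 1) r)) _ _).symm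
  simp only [h2]
  rw [Finset.sum_eq_single (0 : ZMod d)]
  · simp
  · intro r _ hr
    rw [if_neg hr, PF.mono_zero]
  · simp

theorem sqrt_inv_mul : ((√(d : ℝ) : ℝ) : ℂ)⁻¹ * ((√(d : ℝ) : ℝ) : ℂ)⁻¹ * d = 1 := by
  have hd : (d : ℂ) ≠ 0 := Nat.cast_ne_zero.2 (NeZero.ne d)
  rw [← mul_inv, ← Complex.ofReal_mul, Real.mul_self_sqrt (Nat.cast_nonneg d),
    Complex.ofReal_natCast, inv_mul_cancel₀ hd]

theorem twoStringBraid_mem (k : ℕ) : twoStringBraid d k ∈ unitary (PF d ℕ) := by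
  have e : ∀ i l : ZMod d, -(Finsupp.single k l - Finsupp.single (k + 1) l) +
      (Finsupp.single k i - Finsupp.single (k + 1) i) =
      Finsupp.single k (i - l) - Finsupp.single (k + 1) (i - l) := by
    intro i l
    rw [Finsupp.single_sub, Finsupp.single_sub]
    abel
  rw [Unitary.mem_iff, star_twoStringBraid_eq, twoStringBraid_eq]
  constructor
  · rw [smul_mul_smul_comm, Finset.sum_mul_sum]
    have h := sum_pair d k
    have h' : ∀ l i : ZMod d, (PF.mono (-(Finsupp.single k l - Finsupp.single (k + 1) l)) 1 *
        PF.mono (Finsupp.single k i - Finsupp.single (k + 1) i) (qpow (i * i)) : PF d ℕ) =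
        PF.mono (Finsupp.single k (i - l) - Finsupp.single (k + 1) (i - l))
          (qpow (i * (i - l))) := by
      intro l i
      rw [PF.mono_mul_mono, e, cross_neg_left, cross_pair, one_mul, ← qpow_add]
      congr 2
      ring
    simp only [h', h]
    rw [PF.smul_mono, sqrt_inv_mul, PF.one_def]
  · rw [smul_mul_smul_comm, Finset.sum_mul_sum]
    have h := sum_pair d k
    rw [Finset.sum_comm] at h
    have h' : ∀ i l : ZMod d, (PF.mono (Finsupp.single k i - Finsupp.single (k + 1) i)
        (qpow (i * i)) * PF.mono (-(Finsupp.single k l - Finsupp.single (k + 1) l)) 1 : PF d ℕ) =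
        PF.mono (Finsupp.single k (i - l) - Finsupp.single (k + 1) (i - l))
          (qpow (i * (i - l))) := by
      intro i l
      rw [PF.mono_mul_mono, add_comm, e, cross_neg_right, cross_pair, mul_one, ← qpow_add]
      congr 2
      ring
    simp only [h', h]
    rw [PF.smul_mono, sqrt_inv_mul, PF.one_def]

/-- The four-string braid of the `j`-th and `(j + 1)`-st pairs, i.e. of the strings
`2 * j, 2 * j + 1` with the strings `2 * j + 2, 2 * j + 3`. -/
def fourStringBraid (j : ℕ) : unitary (PF d ℕ) :=
  ⟨twoStringBraid d (2 * j + 1), twoStringBraid_mem d _⟩ *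
    ⟨twoStringBraid d (2 * j), twoStringBraid_mem d _⟩ *
    ⟨twoStringBraid d (2 * j + 2), twoStringBraid_mem d _⟩ *
    ⟨twoStringBraid d (2 * j + 1), twoStringBraid_mem d _⟩

/-- The four-string braid group `𝔹_∞`, as a group of unitaries of `PF_∞`. -/
def braidGroup : Subgroup (unitary (PF d ℕ)) := Subgroup.closure (Set.range (fourStringBraid d))

end Braid

/-! ### States -/

/-- A state on a unital `*`-algebra: a normalised positive linear functional. -/
structure IsState {A : Type*} [Ring A] [StarRing A] [Algebra ℂ A] (φ : A →ₗ[ℂ] ℂ) : Prop where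
  map_one : φ 1 = 1
  nonneg : ∀ x, 0 ≤ φ (star x * x)

theorem IsState.map_star {A : Type*} [Ring A] [StarRing A] [Algebra ℂ A] [StarModule ℂ A]
    {φ : A →ₗ[ℂ] ℂ} (h : IsState φ) (x : A) : φ (star x) = star (φ x) := by
  have h0 := (Complex.le_def.1 (h.nonneg x)).2
  have h1 := (Complex.le_def.1 (h.nonneg (1 + x))).2
  have h2 := (Complex.le_def.1 (h.nonneg (1 + Complex.I • x))).2
  have h3 := congrArg Complex.im h.map_one
  simp only [star_add, star_one, star_smul, mul_add, add_mul, one_mul, mul_one, map_add,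
    smul_mul_assoc, mul_smul_comm, map_smul, smul_eq_mul, Complex.add_im, Complex.zero_im,
    Complex.mul_im, Complex.mul_re, Complex.I_re, Complex.I_im, Complex.star_def, Complex.conj_I,
    Complex.neg_im, Complex.neg_re, Complex.one_im] at h0 h1 h2 h3
  apply Complex.ext
  · rw [Complex.star_def, Complex.conj_re]
    linarith
  · rw [Complex.star_def, Complex.conj_im]
    linarith

section States

variable {d : ℕ} [NeZero d]

/-- A functional is neutral if it vanishes on all elements of nonzero charge. -/
def IsNeutral {ι : Type*} [LinearOrder ι] (φ : PF d ι →ₗ[ℂ] ℂ) : Prop :=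
  ∀ k : ZMod d, k ≠ 0 → ∀ x ∈ (PF.charge k : Submodule ℂ (PF d ι)), φ x = 0

/-- `φ = ρ^{⊗∞}`: the value of `φ` on an ordered product of elements `x k` of the copies of `PF_2`
on the successive pairs of strings is the product of the `ρ (x k)`. -/
def IsInfiniteProduct (φ : PF d ℕ →ₗ[ℂ] ℂ) (ρ : PF d (Fin 2) →ₗ[ℂ] ℂ) : Prop :=
  ∀ (n : ℕ) (x : Fin n → PF d (Fin 2)),
    φ (List.ofFn fun k : Fin n => pairIncl d k (x k)).prod = ∏ k, ρ (x k)

/-- The set `S_{𝔹_∞}` of the braid-invariant states on `PF_∞`. -/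
def braidInvariantStates (d : ℕ) [NeZero d] : Set (PF d ℕ →ₗ[ℂ] ℂ) :=
  {φ | IsState φ ∧ ∀ b ∈ braidGroup d, ∀ x, φ ((b : PF d ℕ) * x * star (b : PF d ℕ)) = φ x}

end States

/-! ### The GNS construction -/

/-- The algebra `PF d ι` with the semi-inner product `⟪x, y⟫ = φ (star x * y)`. -/
@[nolint unusedArguments]
def PreGNS {d : ℕ} [NeZero d] {ι : Type*} [LinearOrder ι] {φ : PF d ι →ₗ[ℂ] ℂ}
    (_hφ : IsState φ) : Type _ := PF d ι

section GNS

variable {d : ℕ} [NeZero d] {ι : Type*} [LinearOrder ι] {φ : PF d ι →ₗ[ℂ] ℂ} (hφ : IsState φ)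

instance : AddCommGroup (PreGNS hφ) := inferInstanceAs (AddCommGroup (PF d ι))
instance : Module ℂ (PreGNS hφ) := inferInstanceAs (Module ℂ (PF d ι))

/-- The identity map from the algebra to the pre-GNS space. -/
def toPreGNS : PF d ι ≃ₗ[ℂ] PreGNS hφ := LinearEquiv.refl ℂ _

/-- The semi-inner product on the pre-GNS space. -/
abbrev preGNSCore : PreInnerProductSpace.Core ℂ (PreGNS hφ) where
  inner x y := φ (star ((toPreGNS hφ).symm x) * (toPreGNS hφ).symm y)
  conj_inner_symm x y := by
    rw [← Complex.star_def, ← hφ.map_star, star_mul, star_star]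
  re_inner_nonneg x := (Complex.le_def.1 (hφ.nonneg _)).1
  add_left x y z := by rw [map_add, star_add, add_mul, map_add]
  smul_left x y r := by
    rw [map_smul, star_smul, smul_mul_assoc, map_smul]
    rfl

instance : SeminormedAddCommGroup (PreGNS hφ) :=
  InnerProductSpace.Core.toSeminormedAddCommGroup (c := preGNSCore hφ)
instance : InnerProductSpace ℂ (PreGNS hφ) := InnerProductSpace.ofCore (preGNSCore hφ)

theorem preGNS_inner (x y : PF d ι) :
    ⟪toPreGNS hφ x, toPreGNS hφ y⟫_ℂ = φ (star x * y) := rfl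

/-- The Hilbert space of the GNS construction. -/
abbrev GNS := Completion (PreGNS hφ)

/-- The cyclic vector `Ω` of the GNS construction. -/
def gnsVector : GNS hφ := ((toPreGNS hφ 1 : PreGNS hφ) : GNS hφ)

/-- Left multiplication on the pre-GNS space. -/
def leftMul (a : PF d ι) : PreGNS hφ →ₗ[ℂ] PreGNS hφ :=
  (toPreGNS hφ).toLinearMap ∘ₗ LinearMap.mulLeft ℂ a ∘ₗ (toPreGNS hφ).symm.toLinearMap

theorem leftMul_toPreGNS (a x : PF d ι) :
    leftMul hφ a (toPreGNS hφ x) = toPreGNS hφ (a * x) := rfl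

theorem norm_leftMul_mono (a : ι →₀ ZMod d) (x : PreGNS hφ) :
    ‖leftMul hφ (PF.mono a 1) x‖ = ‖x‖ := by
  obtain ⟨x, rfl⟩ := (toPreGNS hφ).surjective x
  rw [leftMul_toPreGNS, @norm_eq_sqrt_re_inner ℂ, @norm_eq_sqrt_re_inner ℂ, preGNS_inner,
    preGNS_inner, star_mul, mul_assoc, ← mul_assoc (star (PF.mono a 1)), PF.star_mono_mul_mono,
    one_mul]

theorem leftMul_bounded (a : PF d ι) : ∃ C : ℝ, ∀ x, ‖leftMul hφ a x‖ ≤ C * ‖x‖ := by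
  induction a using PF.induction_mono with
  | zero =>
    refine ⟨0, fun x => ?_⟩
    obtain ⟨x, rfl⟩ := (toPreGNS hφ).surjective x
    rw [leftMul_toPreGNS]
    simp
  | add a b ha hb =>
    obtain ⟨C, hC⟩ := ha
    obtain ⟨D, hD⟩ := hb
    refine ⟨C + D, fun x => ?_⟩
    have h : leftMul hφ (a + b) x = leftMul hφ a x + leftMul hφ b x := by
      obtain ⟨x, rfl⟩ := (toPreGNS hφ).surjective x
      simp only [leftMul_toPreGNS, add_mul, map_add]
    rw [h, add_mul]
    exact (norm_add_le _ _).trans (add_le_add (hC x) (hD x))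
  | mono a s =>
    refine ⟨‖s‖, fun x => ?_⟩
    have h : leftMul hφ (PF.mono a s) x = s • leftMul hφ (PF.mono a 1) x := by
      obtain ⟨x, rfl⟩ := (toPreGNS hφ).surjective x
      rw [leftMul_toPreGNS, leftMul_toPreGNS, ← map_smul, ← smul_mul_assoc, PF.smul_mono, mul_one]
    rw [h, norm_smul, norm_leftMul_mono]

/-- Left multiplication on the pre-GNS space, as a bounded operator. -/
def leftMulCLM (a : PF d ι) : PreGNS hφ →L[ℂ] PreGNS hφ :=
  (leftMul hφ a).mkContinuousOfExistsBound (leftMul_bounded hφ a)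

theorem leftMulCLM_toPreGNS (a x : PF d ι) :
    leftMulCLM hφ a (toPreGNS hφ x) = toPreGNS hφ (a * x) := rfl

/-- The operator on the GNS space given by an element of the algebra. -/
def gnsOp (a : PF d ι) : GNS hφ →L[ℂ] GNS hφ := (leftMulCLM hφ a).completion

theorem gnsOp_coe (a x : PF d ι) :
    gnsOp hφ a ((toPreGNS hφ x : PreGNS hφ) : GNS hφ) =
      ((toPreGNS hφ (a * x) : PreGNS hφ) : GNS hφ) := by
  rw [gnsOp, ContinuousLinearMap.completion_apply_coe, leftMulCLM_toPreGNS]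

theorem gns_ext {S T : GNS hφ →L[ℂ] GNS hφ}
    (h : ∀ x : PF d ι, S ((toPreGNS hφ x : PreGNS hφ) : GNS hφ) =
      T ((toPreGNS hφ x : PreGNS hφ) : GNS hφ)) : S = T := by
  ext v
  induction v using Completion.induction_on with
  | hp => exact isClosed_eq S.continuous T.continuous
  | ih v => exact h ((toPreGNS hφ).symm v)

/-- The GNS representation of the parafermion algebra. -/
def gnsRep : PF d ι →⋆ₐ[ℂ] (GNS hφ →L[ℂ] GNS hφ) where
  toFun := gnsOp hφ
  map_one' := gns_ext hφ fun x => by rw [gnsOp_coe, one_mul]; rfl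
  map_zero' := gns_ext hφ fun x => by
    rw [gnsOp_coe, zero_mul, map_zero, Completion.coe_zero]; rfl
  map_mul' a b := gns_ext hφ fun x => by
    rw [mul_apply_eq_comp, gnsOp_coe, gnsOp_coe, gnsOp_coe, mul_assoc]
  map_add' a b := gns_ext hφ fun x => by
    rw [add_apply, gnsOp_coe, gnsOp_coe, gnsOp_coe, add_mul, map_add,
      Completion.coe_add]
  commutes' r := gns_ext hφ fun x => by
    rw [gnsOp_coe, Algebra.algebraMap_eq_smul_one, Algebra.algebraMap_eq_smul_one, smul_mul_assoc,
      one_mul, map_smul, Completion.coe_smul]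
    rfl
  map_star' a := by
    refine (ContinuousLinearMap.eq_adjoint_iff _ _).2 fun v w => ?_
    induction v, w using Completion.induction_on₂ with
    | hp => apply isClosed_eq <;> fun_prop
    | ih v w =>
      obtain ⟨x, rfl⟩ := (toPreGNS hφ).surjective v
      obtain ⟨y, rfl⟩ := (toPreGNS hφ).surjective w
      rw [gnsOp_coe, gnsOp_coe, Completion.inner_coe, Completion.inner_coe, preGNS_inner,
        preGNS_inner, star_mul, star_star, mul_assoc]

theorem inner_gnsVector (x : PF d ι) : ⟪gnsVector hφ, gnsRep hφ x (gnsVector hφ)⟫_ℂ = φ x := by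
  change ⟪gnsVector hφ, gnsOp hφ x (gnsVector hφ)⟫_ℂ = φ x
  rw [gnsVector, gnsOp_coe, Completion.inner_coe, preGNS_inner, star_one, one_mul, mul_one]

end GNS

/-! ### Von Neumann algebras of a state -/

/-- The von Neumann algebra generated by a set of bounded operators: the double commutant of the
set and its adjoints. -/
def vonNeumannGen {H : Type*} [NormedAddCommGroup H] [InnerProductSpace ℂ H] [CompleteSpace H]
    (S : Set (H →L[ℂ] H)) : VonNeumannAlgebra H where
  toStarSubalgebra := StarSubalgebra.centralizer ℂ (StarSubalgebra.centralizer ℂ S : Set (H →L[ℂ] H))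
  centralizer_centralizer' := by
    change Set.centralizer (Set.centralizer (SetLike.coe
      (StarSubalgebra.centralizer ℂ (StarSubalgebra.centralizer ℂ S : Set (H →L[ℂ] H))))) =
      SetLike.coe (StarSubalgebra.centralizer ℂ (StarSubalgebra.centralizer ℂ S : Set (H →L[ℂ] H)))
    rw [StarSubalgebra.coe_centralizer_centralizer, Set.centralizer_centralizer_centralizer]

/-- A von Neumann algebra is a factor if its center consists of the scalars. -/
def IsFactor {H : Type*} [NormedAddCommGroup H] [InnerProductSpace ℂ H] [CompleteSpace H]
    (M : VonNeumannAlgebra H) : Prop :=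
  M.toStarSubalgebra ⊓ M.commutant.toStarSubalgebra = ⊥

section VonNeumann

variable {d : ℕ} [NeZero d] {φ : PF d ℕ →ₗ[ℂ] ℂ} (hφ : IsState φ)

/-- The von Neumann algebra generated by `PF_∞` in the GNS representation of `φ`. -/
def gnsAlgebra : VonNeumannAlgebra (GNS hφ) := vonNeumannGen (Set.range (gnsRep hφ))

/-- The image of `gnsAlgebra` under the `n`-th power of the double shift: the von Neumann algebra
generated by the `n`-fold shifts of the elements of `PF_∞`. -/
def shiftedAlgebra (n : ℕ) : VonNeumannAlgebra (GNS hφ) :=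
  vonNeumannGen (Set.range fun x => gnsRep hφ ((doubleShift d)^[n] x))

/-- The tail algebra. -/
def tailAlgebra : StarSubalgebra ℂ (GNS hφ →L[ℂ] GNS hφ) :=
  ⨅ n, (shiftedAlgebra hφ n).toStarSubalgebra

/-- The von Neumann algebra generated by the elements of charge zero. -/
def neutralAlgebra : VonNeumannAlgebra (GNS hφ) :=
  vonNeumannGen (gnsRep hφ '' (PF.charge 0 : Submodule ℂ (PF d ℕ)))

/-- The neutral part of the tail algebra. -/
def neutralTailAlgebra : StarSubalgebra ℂ (GNS hφ →L[ℂ] GNS hφ) :=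
  tailAlgebra hφ ⊓ (neutralAlgebra hφ).toStarSubalgebra

/-- The elements of `gnsAlgebra` fixed by the adjoint action of the braid group. -/
def braidFixedPoints : Set (GNS hφ →L[ℂ] GNS hφ) :=
  {X | X ∈ gnsAlgebra hφ ∧ ∀ b ∈ braidGroup d,
    gnsRep hφ (b : PF d ℕ) * X * star (gnsRep hφ (b : PF d ℕ)) = X}

/-- The vector `Ω` is separating for `gnsAlgebra`; equivalently, the normal extension of `φ` to
`gnsAlgebra` is faithful. -/
def IsSeparating : Prop := ∀ X ∈ gnsAlgebra hφ, X (gnsVector hφ) = 0 → X = 0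

end VonNeumann

end

/-!
Write `π`, `Ω`, `M` for the GNS data of a braid-invariant state `φ`, and `α` for the double shift.

The four-string braid `b j` carries the `j`-th pair of strings to the next one exactly, with no
charge-dependent factor, and commutes with the strings outside its two pairs. So on each element `α`
agrees with the adjoint action of a braid (`exists_braid_eq_shift`), `φ` is `α`-invariant, and
`φ (x * α^n y)` does not depend on `n` once `n` is large
(`braidInvariantStates.mul_shift_eq`). The mean ergodic theorem then computes these eventual values
as `⟪star x Ω, P (y Ω)⟫` with the projection `P` on the vectors fixed by the isometry
`x Ω ↦ α x Ω` (`exists_ergodicProjection`).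

*Neutrality.* For a monomial `x` of charge `t` the eventual values of `φ (star x * α^n x)` and
`φ (x * α^n (star x))` are `‖P (x Ω)‖ ^ 2` and `‖P (star x Ω)‖ ^ 2`, and they differ by the phase
`q ^ (-t * t)`. As `d` is square-free, this phase is not `1` for `t ≠ 0`, so `P (x Ω) = 0` and
`φ x = 0`. The same positivity argument, applied to the components of an operator under the
unitaries implementing the charge grading, shows that the tail algebra is central
(`commute_of_mem_tailAlgebra`); in particular it is fixed by the braids.

*The equivalences.* A central self-adjoint `Z` with `⟪Ω, Z Ω⟫ = 0` yields invariant states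
`x ↦ ⟪Ω, (1 ± ε Z) (x Ω)⟫` with mean `φ`, so extreme states are factor states
(`isFactor_of_mem_extremePoints`). For factor states the central tail algebra is trivial. If its
neutral part is trivial, weak limits of `π (α^n y)`, `y` neutral, are scalars, and `φ` is clustering
(`isClustering_of_neutralTailAlgebra_eq_bot`), which makes it a product state by induction on the
number of pairs. A product state is clustering, so the ergodic means of an `x` with `φ x = 0`
tend to zero on `Ω`; this forces `ψ x = 0` for each invariant `ψ` dominated by a multiple of `φ`,
and `φ` is extreme (`mem_extremePoints_of_isClustering`).

*Braid fixed points.* If `Ω` is separating and `X = star X` is fixed by the braids, choose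
self-adjoint `x` with `x Ω` close to `X Ω`. The shifts `α^n x` are conjugates of `x` by braids, so
`α^n x Ω` is as close to `X Ω`; on the dense set of vectors `Y Ω`, `Y` in the commutant of `M`, this
lets `X` inherit commutation relations from the `α^n x` (`mem_tailAlgebra_of_isSelfAdjoint`).
-/

/-! ### Monomials, charges and shifts -/

namespace PF

section General

variable {d : ℕ} {ι κ : Type*}

/-- The total exponent of a monomial modulo `d`: the charge of `mono a 1`. -/
noncomputable def deg : (ι →₀ ZMod d) →+ ZMod d := Finsupp.liftAddHom fun _ => AddMonoidHom.id _

theorem deg_apply (a : ι →₀ ZMod d) : deg a = a.sum fun _ s => s := rfl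

@[simp] theorem deg_single (j : ι) (s : ZMod d) : deg (Finsupp.single j s) = s := by
  simp [deg_apply]

@[simp] theorem deg_mapDomain (f : ι → κ) (a : ι →₀ ZMod d) : deg (a.mapDomain f) = deg a := by
  induction a using Finsupp.induction_linear with
  | zero => simp
  | add a b ha hb => rw [Finsupp.mapDomain_add, map_add, map_add, ha, hb]
  | single j s => simp

section

variable [LinearOrder ι]

theorem cross_eq_zero_of_lt {a b : ι →₀ ZMod d} (h : ∀ j ∈ a.support, ∀ k ∈ b.support, j < k) :
    cross a b = 0 := by
  unfold cross
  refine Finset.sum_eq_zero fun j hj => Finset.sum_eq_zero fun k hk => ?_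
  exact if_neg (h j hj k hk).not_gt

theorem cross_eq_deg_mul_deg_of_lt {a b : ι →₀ ZMod d}
    (h : ∀ j ∈ a.support, ∀ k ∈ b.support, j < k) : cross b a = deg b * deg a := by
  rw [deg_apply, deg_apply]
  unfold cross Finsupp.sum
  rw [Finset.sum_mul_sum]
  refine Finset.sum_congr rfl fun k hk => Finset.sum_congr rfl fun j hj => ?_
  exact if_pos (h j hj k hk)

end

variable [NeZero d] [LinearOrder ι] [LinearOrder κ]

/-- Monomials on separated strings commute up to the phase given by the product of charges. -/
theorem mono_mul_mono_of_lt {a b : ι →₀ ZMod d}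
    (h : ∀ j ∈ a.support, ∀ k ∈ b.support, j < k) :
    (mono a 1 * mono b 1 : PF d ι) = qpow (deg a * deg b) • (mono b 1 * mono a 1) := by
  rw [mono_mul_mono, mono_mul_mono, smul_mono, cross_eq_zero_of_lt h, cross_eq_deg_mul_deg_of_lt h,
    add_comm b a, neg_zero, qpow_zero, mul_one, one_mul, one_mul, ← qpow_add,
    mul_comm (deg b), add_neg_cancel, qpow_zero]

theorem map_mono (f : ι ↪o κ) (a : ι →₀ ZMod d) (s : ℂ) :
    map f (mono a s : PF d ι) = mono (a.mapDomain f) s := by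
  change ofBasis _ (mono _ _) = _
  rw [ofBasis_mono, smul_mono, mul_one]

theorem mono_eq_smul (a : ι →₀ ZMod d) (s : ℂ) : (mono a s : PF d ι) = s • mono a 1 := by
  rw [smul_mono, mul_one]

/-- Linear maps on a parafermion algebra are determined by their values on monomials. -/
theorem linearMap_ext {M : Type*} [AddCommMonoid M] [Module ℂ M] {f g : PF d ι →ₗ[ℂ] M}
    (h : ∀ a, f (mono a 1) = g (mono a 1)) : f = g := by
  ext x
  induction x using induction_mono with
  | zero => simp
  | add x y hx hy => rw [map_add, map_add, hx, hy]
  | mono a s => rw [mono_eq_smul, map_smul, map_smul, h]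

/-- The generators `c j` generate the algebra without taking adjoints, as `star (c j)` is a power
of `c j`. -/
theorem eq_top_of_c_mem {S : Subalgebra ℂ (PF d ι)} (h : ∀ j, c j ∈ S) : S = ⊤ := by
  have hm : ∀ a : ι →₀ ZMod d, (mono a 1 : PF d ι) ∈ S := by
    intro a
    induction a using Finsupp.induction_linear with
    | zero => exact one_mem _
    | add a b ha hb =>
      have h : (mono (a + b) 1 : PF d ι) = qpow (cross a b) • (mono a 1 * mono b 1) := by
        rw [mono_mul_mono, smul_mono]
        simp [← qpow_add]
      rw [h]
      exact S.smul_mem (mul_mem ha hb) _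
    | single j s =>
      rw [← ZMod.natCast_zmod_val s, ← c_pow]
      exact pow_mem (h j) _
  refine eq_top_iff.2 fun x _ => ?_
  induction x using induction_mono with
  | zero => exact zero_mem _
  | add x y hx hy => exact add_mem (hx trivial) (hy trivial)
  | mono a s =>
    rw [mono_eq_smul]
    exact S.smul_mem (hm a) _

end General

end PF

section Shift

variable {d : ℕ} [NeZero d]

/-- The `n`-fold double shift `c j ↦ c (j + 2 * n)`. -/
noncomputable def shift (n : ℕ) : PF d ℕ →⋆ₐ[ℂ] PF d ℕ :=
  PF.map (OrderEmbedding.ofStrictMono (fun j => j + 2 * n) fun _ _ h =>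
    Nat.add_lt_add_right h (2 * n))

theorem shift_c (n j : ℕ) : shift n (PF.c j : PF d ℕ) = PF.c (j + 2 * n) := PF.map_c _ _

theorem shift_mono (n : ℕ) (a : ℕ →₀ ZMod d) (s : ℂ) :
    shift n (PF.mono a s) = PF.mono (a.mapDomain (· + 2 * n)) s := PF.map_mono _ _ _

theorem pairIncl_mono (k : ℕ) (a : Fin 2 →₀ ZMod d) (s : ℂ) :
    pairIncl d k (PF.mono a s) = PF.mono (a.mapDomain fun i : Fin 2 => 2 * k + (i : ℕ)) s :=
  PF.map_mono _ _ _

theorem shift_shift (m n : ℕ) (x : PF d ℕ) : shift m (shift n x) = shift (m + n) x := by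
  induction x using PF.induction_mono with
  | zero => simp
  | add x y hx hy => simp only [map_add, hx, hy]
  | mono a s =>
    rw [shift_mono, shift_mono, shift_mono, ← Finsupp.mapDomain_comp]
    congr 2
    funext j
    simp only [Function.comp]
    ring

theorem shift_zero (x : PF d ℕ) : shift 0 x = x := by
  induction x using PF.induction_mono with
  | zero => simp
  | add x y hx hy => simp only [map_add, hx, hy]
  | mono a s =>
    rw [shift_mono]
    exact congrArg (PF.mono · s) Finsupp.mapDomain_id

theorem doubleShift_iterate (n : ℕ) (x : PF d ℕ) : (doubleShift d)^[n] x = shift n x := by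
  induction n with
  | zero => exact (shift_zero x).symm
  | succ n ih =>
    rw [Function.iterate_succ_apply', ih]
    exact (shift_shift 1 n x).trans (by rw [add_comm])

theorem shift_pairIncl (n k : ℕ) (x : PF d (Fin 2)) :
    shift n (pairIncl d k x) = pairIncl d (n + k) x := by
  induction x using PF.induction_mono with
  | zero => simp
  | add x y hx hy => simp only [map_add, hx, hy]
  | mono a s =>
    rw [pairIncl_mono, pairIncl_mono, shift_mono, ← Finsupp.mapDomain_comp]
    congr 2
    funext j
    simp only [Function.comp]
    ring

/-- Every monomial commutes, up to the phase given by the charges, with far enough shifts of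
monomials. -/
theorem eventually_mono_mul_shift_mono (a : ℕ →₀ ZMod d) :
    ∀ᶠ n in Filter.atTop, ∀ b : ℕ →₀ ZMod d,
      PF.mono a 1 * shift n (PF.mono b 1) =
        qpow (PF.deg a * PF.deg b) • (shift n (PF.mono b 1) * PF.mono a 1) := by
  obtain ⟨N, hN⟩ := a.support.exists_nat_subset_range
  filter_upwards [Filter.eventually_ge_atTop N] with n hn b
  rw [shift_mono, PF.mono_mul_mono_of_lt, PF.deg_mapDomain]
  intro j hj k hk
  have h1 := Finset.mem_range.1 (hN hj)
  obtain ⟨l, -, rfl⟩ := Finset.mem_image.1 (Finsupp.mapDomain_support hk)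
  omega

end Shift

/-! ### The action of the braids on the strings -/

section Braid

variable {d : ℕ} [NeZero d]

theorem shift_twoStringBraid (n k : ℕ) :
    shift n (twoStringBraid d k) = twoStringBraid d (k + 2 * n) := by
  unfold twoStringBraid
  simp only [map_smul, map_sum, map_mul, map_pow, map_star, shift_c]
  rw [add_right_comm]

/-- Conjugation by the braid of the strings `k`, `k + 1` carries `c k` exactly to `c (k + 1)`. -/
theorem twoStringBraid_mul_c (k : ℕ) :
    twoStringBraid d k * PF.c k = PF.c (k + 1) * twoStringBraid d k := by
  rw [twoStringBraid_eq, smul_mul_assoc, mul_smul_comm, Finset.sum_mul, Finset.mul_sum]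
  congr 1
  refine Fintype.sum_equiv (Equiv.addRight 1) _ _ fun i => ?_
  rw [PF.c, PF.c, PF.mono_mul_mono, PF.mono_mul_mono, Equiv.coe_addRight]
  congr 1
  · rw [Finsupp.single_add, Finsupp.single_add]
    abel
  · simp only [sub_eq_add_neg, cross_add_left, cross_add_right, cross_neg_left, cross_neg_right,
      cross_single, mul_one, one_mul, ← qpow_add]
    congr 1
    simp
    ring

theorem commute_twoStringBraid_c {k j : ℕ} (h : j < k ∨ k + 1 < j) :
    Commute (twoStringBraid d k) (PF.c j) := by
  rw [twoStringBraid_eq]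
  refine Commute.smul_left (Commute.sum_left _ _ _ fun i _ => ?_) _
  change _ * _ = _ * _
  rw [PF.c, PF.mono_mul_mono, PF.mono_mul_mono, add_comm, mul_comm (1 : ℂ)]
  congr 3
  rcases h with h | h
  · simp [sub_eq_add_neg, cross_add_left, cross_add_right, cross_single, h, h.not_gt,
      show ¬ (k + 1 < j) by omega, show j < k + 1 by omega]
  · simp [sub_eq_add_neg, cross_add_left, cross_add_right, cross_single, h, h.not_gt,
      show ¬ (j < k) by omega, show k < j by omega]

theorem fourStringBraid_mul_c (j : ℕ) (i : ℕ) (hi : i = 2 * j ∨ i = 2 * j + 1) :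
    (fourStringBraid d j : PF d ℕ) * PF.c i = PF.c (i + 2) * (fourStringBraid d j : PF d ℕ) := by
  have e : (fourStringBraid d j : PF d ℕ) = twoStringBraid d (2 * j + 1) * twoStringBraid d (2 * j)
    * twoStringBraid d (2 * j + 2) * twoStringBraid d (2 * j + 1) := rfl
  rw [e]
  rcases hi with rfl | rfl
  · have h1 := (commute_twoStringBraid_c (d := d) (k := 2 * j + 1) (j := 2 * j) (by omega)).eq
    have h2 := (commute_twoStringBraid_c (d := d) (k := 2 * j + 2) (j := 2 * j) (by omega)).eq
    have h3 := twoStringBraid_mul_c (d := d) (2 * j)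
    have h4 := twoStringBraid_mul_c (d := d) (2 * j + 1)
    rw [mul_assoc, h1, ← mul_assoc, mul_assoc _ _ (PF.c _), h2, ← mul_assoc, mul_assoc _ _ (PF.c _),
      h3, ← mul_assoc, h4]
    simp only [mul_assoc]
  · have h1 := twoStringBraid_mul_c (d := d) (2 * j + 1)
    have h2 := twoStringBraid_mul_c (d := d) (2 * j + 2)
    have h3 := (commute_twoStringBraid_c (d := d) (k := 2 * j) (j := 2 * j + 3) (by omega)).eq
    have h4 := (commute_twoStringBraid_c (d := d) (k := 2 * j + 1) (j := 2 * j + 3) (by omega)).eq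
    rw [mul_assoc, h1, ← mul_assoc, mul_assoc _ _ (PF.c _), h2, ← mul_assoc, mul_assoc _ _ (PF.c _),
      h3, ← mul_assoc, h4]
    simp only [mul_assoc]

theorem commute_fourStringBraid_c {j i : ℕ} (h : i < 2 * j ∨ 2 * j + 3 < i) :
    Commute (fourStringBraid d j : PF d ℕ) (PF.c i) := by
  have h1 := commute_twoStringBraid_c (d := d) (k := 2 * j + 1) (j := i) (by omega)
  have h2 := commute_twoStringBraid_c (d := d) (k := 2 * j) (j := i) (by omega)
  have h3 := commute_twoStringBraid_c (d := d) (k := 2 * j + 2) (j := i) (by omega)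
  exact ((h1.mul_left h2).mul_left h3).mul_left h1

/-- The braid `b 0 * b 1 * ⋯ * b (n - 1)`, which moves each of the first `n` pairs of strings to the
next one. -/
noncomputable def shiftBraid (d : ℕ) [NeZero d] : ℕ → unitary (PF d ℕ)
  | 0 => 1
  | n + 1 => shiftBraid d n * fourStringBraid d n

theorem shiftBraid_mem (n : ℕ) : shiftBraid d n ∈ braidGroup d := by
  induction n with
  | zero => exact one_mem _
  | succ n ih => exact mul_mem ih (Subgroup.subset_closure (Set.mem_range_self n))

theorem commute_shiftBraid_c {n i : ℕ} (h : 2 * n + 2 ≤ i) :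
    Commute (shiftBraid d n : PF d ℕ) (PF.c i) := by
  induction n with
  | zero => exact Commute.one_left _
  | succ n ih => exact (ih (by omega)).mul_left (commute_fourStringBraid_c (by omega))

theorem shiftBraid_mul_c {n i : ℕ} (h : i < 2 * n) :
    (shiftBraid d n : PF d ℕ) * PF.c i = PF.c (i + 2) * (shiftBraid d n : PF d ℕ) := by
  induction n with
  | zero => omega
  | succ n ih =>
    change (shiftBraid d n : PF d ℕ) * (fourStringBraid d n : PF d ℕ) * PF.c i =
      PF.c (i + 2) * ((shiftBraid d n : PF d ℕ) * (fourStringBraid d n : PF d ℕ))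
    by_cases hi : i < 2 * n
    · rw [mul_assoc, (commute_fourStringBraid_c (Or.inl hi)).eq, ← mul_assoc, ih hi, mul_assoc]
    · rw [mul_assoc, fourStringBraid_mul_c n i (by omega), ← mul_assoc,
        (commute_shiftBraid_c (by omega)).eq, mul_assoc]

/-- On each element the conjugation by `shiftBraid d n` agrees with the double shift for large
`n`. -/
theorem eventually_shiftBraid_mul (x : PF d ℕ) :
    ∀ᶠ n in Filter.atTop,
      (shiftBraid d n : PF d ℕ) * x = shift 1 x * (shiftBraid d n : PF d ℕ) := by
  let S : Subalgebra ℂ (PF d ℕ) :=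
    { carrier := {x | ∀ᶠ n in Filter.atTop,
        (shiftBraid d n : PF d ℕ) * x = shift 1 x * (shiftBraid d n : PF d ℕ)}
      mul_mem' := fun {x y} hx hy => by
        filter_upwards [hx, hy] with n hx hy
        rw [← mul_assoc, hx, mul_assoc, hy, map_mul, mul_assoc]
      add_mem' := fun {x y} hx hy => by
        filter_upwards [hx, hy] with n hx hy
        rw [mul_add, hx, hy, map_add, add_mul]
      algebraMap_mem' := fun r => Filter.Eventually.of_forall fun n => by
        rw [← Algebra.commutes, AlgHomClass.commutes] }
  have hS : S = ⊤ := PF.eq_top_of_c_mem fun j => by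
    change ∀ᶠ n in Filter.atTop, _
    filter_upwards [Filter.eventually_gt_atTop j] with n hn
    rw [shift_c]
    exact shiftBraid_mul_c (by omega)
  exact (hS ▸ Algebra.mem_top : x ∈ S)

theorem exists_mem_braidGroup_eq_shift (m : ℕ) {b : unitary (PF d ℕ)} (hb : b ∈ braidGroup d) :
    ∃ b' ∈ braidGroup d, (b' : PF d ℕ) = shift m (b : PF d ℕ) := by
  induction hb using Subgroup.closure_induction with
  | mem b hb =>
    obtain ⟨j, rfl⟩ := hb
    refine ⟨fourStringBraid d (j + m), Subgroup.subset_closure (Set.mem_range_self _), ?_⟩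
    change _ * _ * _ * _ = shift m (_ * _ * _ * _)
    simp only [map_mul, shift_twoStringBraid]
    rw [show 2 * j + 1 + 2 * m = 2 * (j + m) + 1 by ring, show 2 * j + 2 * m = 2 * (j + m) by ring,
      show 2 * j + 2 + 2 * m = 2 * (j + m) + 2 by ring]
  | one => exact ⟨1, one_mem _, (map_one (shift m)).symm⟩
  | mul b e _ _ hb he =>
    obtain ⟨b', hb', hb⟩ := hb
    obtain ⟨e', he', he⟩ := he
    refine ⟨b' * e', mul_mem hb' he', ?_⟩
    rw [Submonoid.coe_mul, Submonoid.coe_mul, map_mul, hb, he]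
  | inv b _ hb =>
    obtain ⟨b', hb', hb⟩ := hb
    refine ⟨b'⁻¹, inv_mem hb', ?_⟩
    change star (b' : PF d ℕ) = shift m (star (b : PF d ℕ))
    rw [map_star, hb]

/-- The elements commuting with all braids of the strings from `2 * m` on. They include all
elements on the first `m` pairs of strings. -/
noncomputable def braidCommutant (d : ℕ) [NeZero d] (m : ℕ) : Subalgebra ℂ (PF d ℕ) :=
  Subalgebra.centralizer ℂ {x | ∃ k, 2 * m ≤ k ∧ x = twoStringBraid d k}

theorem mem_braidCommutant {m : ℕ} {x : PF d ℕ} :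
    x ∈ braidCommutant d m ↔ ∀ k, 2 * m ≤ k → Commute (twoStringBraid d k) x := by
  constructor
  · exact fun h k hk => Subalgebra.mem_centralizer_iff ℂ |>.1 h _ ⟨k, hk, rfl⟩
  · refine fun h => Subalgebra.mem_centralizer_iff ℂ |>.2 ?_
    rintro _ ⟨k, hk, rfl⟩
    exact h k hk

theorem braidCommutant_mono {m n : ℕ} (h : m ≤ n) : braidCommutant d m ≤ braidCommutant d n :=
  fun _ hx => mem_braidCommutant.2 fun k hk => mem_braidCommutant.1 hx k (by omega)

theorem c_mem_braidCommutant {m j : ℕ} (h : j < 2 * m) : PF.c j ∈ braidCommutant d m :=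
  mem_braidCommutant.2 fun _ _ => commute_twoStringBraid_c (Or.inl (by omega))

theorem eventually_mem_braidCommutant (x : PF d ℕ) :
    ∀ᶠ m in Filter.atTop, x ∈ braidCommutant d m := by
  let S : Subalgebra ℂ (PF d ℕ) :=
    { carrier := {x | ∀ᶠ m in Filter.atTop, x ∈ braidCommutant d m}
      mul_mem' := fun {x y} hx hy => by
        filter_upwards [hx, hy] with m hx hy using mul_mem hx hy
      add_mem' := fun {x y} hx hy => by
        filter_upwards [hx, hy] with m hx hy using add_mem hx hy
      algebraMap_mem' := fun r => Filter.Eventually.of_forall fun m => algebraMap_mem _ r }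
  have hS : S = ⊤ := PF.eq_top_of_c_mem fun j => by
    change ∀ᶠ m in Filter.atTop, _
    filter_upwards [Filter.eventually_gt_atTop j] with m hm
    exact c_mem_braidCommutant (by omega)
  exact (hS ▸ Algebra.mem_top : x ∈ S)

theorem pairIncl_mem_braidCommutant {k m : ℕ} (h : k < m) (x : PF d (Fin 2)) :
    pairIncl d k x ∈ braidCommutant d m := by
  have hS : (braidCommutant d m).comap (pairIncl d k).toAlgHom = ⊤ :=
    PF.eq_top_of_c_mem fun j => by
      change pairIncl d k (PF.c j) ∈ braidCommutant d m
      rw [pairIncl, PF.map_c]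
      refine c_mem_braidCommutant ?_
      change 2 * k + (j : ℕ) < 2 * m
      omega
  exact (hS ▸ Algebra.mem_top : x ∈ (braidCommutant d m).comap (pairIncl d k).toAlgHom)

theorem commute_shift_of_mem_braidCommutant {m : ℕ} {x : PF d ℕ} (hx : x ∈ braidCommutant d m)
    {b : unitary (PF d ℕ)} (hb : b ∈ braidGroup d) : Commute (shift m (b : PF d ℕ)) x := by
  have h : ∀ k, Commute (shift m (twoStringBraid d k)) x := fun k => by
    rw [shift_twoStringBraid]
    exact mem_braidCommutant.1 hx _ (by omega)
  induction hb using Subgroup.closure_induction with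
  | mem b hb =>
    obtain ⟨j, rfl⟩ := hb
    change Commute (shift m (_ * _ * _ * _)) x
    simp only [map_mul]
    exact (((h _).mul_left (h _)).mul_left (h _)).mul_left (h _)
  | one =>
    rw [OneMemClass.coe_one, map_one]
    exact Commute.one_left _
  | mul b e _ _ hb he =>
    rw [Submonoid.coe_mul, map_mul]
    exact hb.mul_left he
  | inv b _ hb =>
    change shift m (star (b : PF d ℕ)) * x = x * shift m (star (b : PF d ℕ))
    have h1 : shift m (star (b : PF d ℕ)) * shift m (b : PF d ℕ) = 1 := by
      rw [← map_mul, Unitary.star_mul_self_of_mem (Subtype.property _), map_one]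
    have h2 : shift m (b : PF d ℕ) * shift m (star (b : PF d ℕ)) = 1 := by
      rw [← map_mul, Unitary.mul_star_self_of_mem (Subtype.property _), map_one]
    calc _ = shift m (star (b : PF d ℕ)) * (x * shift m (b : PF d ℕ)) *
          shift m (star (b : PF d ℕ)) := by rw [mul_assoc, mul_assoc, h2, mul_one]
      _ = _ := by rw [← hb.eq, ← mul_assoc, h1, one_mul]

/-- On each element the double shift agrees with the adjoint action of a braid. -/
theorem exists_braid_eq_shift (n : ℕ) (x : PF d ℕ) :
    ∃ b ∈ braidGroup d, (b : PF d ℕ) * x * star (b : PF d ℕ) = shift n x := by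
  induction n with
  | zero => exact ⟨1, one_mem _, by simp [shift_zero]⟩
  | succ n ih =>
    obtain ⟨b, hb, h⟩ := ih
    obtain ⟨N, hN⟩ := (eventually_shiftBraid_mul (shift n x)).exists
    refine ⟨shiftBraid d N * b, mul_mem (shiftBraid_mem N) hb, ?_⟩
    rw [shift_shift, add_comm] at hN
    rw [Submonoid.coe_mul, star_mul, mul_assoc, mul_assoc, ← mul_assoc (b : PF d ℕ),
      ← mul_assoc ((b : PF d ℕ) * x), h, ← mul_assoc, hN, mul_assoc,
      Unitary.mul_star_self_of_mem (Subtype.property _),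
      mul_one]

end Braid

section Invariant

variable {d : ℕ} [NeZero d] {φ : PF d ℕ →ₗ[ℂ] ℂ}

theorem braidInvariantStates.map_shift (hφ : φ ∈ braidInvariantStates d) (n : ℕ) (x : PF d ℕ) :
    φ (shift n x) = φ x := by
  obtain ⟨b, hb, h⟩ := exists_braid_eq_shift n x
  rw [← h, hφ.2 b hb]

/-- For a braid-invariant state, the correlation with the shifts of an element does not depend on
the shift once it moves the element past the strings of the other factor. -/
theorem braidInvariantStates.mul_shift_eq (hφ : φ ∈ braidInvariantStates d) {m n : ℕ} (h : m ≤ n)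
    {x : PF d ℕ} (hx : x ∈ braidCommutant d m) (y : PF d ℕ) :
    φ (x * shift n y) = φ (x * shift m y) := by
  induction n, h using Nat.le_induction with
  | base => rfl
  | succ n hn ih =>
    rw [← ih]
    obtain ⟨N, hN⟩ := (eventually_shiftBraid_mul y).exists
    obtain ⟨b, hb, e⟩ := exists_mem_braidGroup_eq_shift n (shiftBraid_mem (d := d) N)
    have h1 := commute_shift_of_mem_braidCommutant (braidCommutant_mono hn hx)
      (shiftBraid_mem (d := d) N)
    rw [← e] at h1
    have h2 := congrArg (shift n) hN
    rw [map_mul, map_mul, shift_shift, ← e] at h2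
    rw [← hφ.2 b hb (x * shift n y), ← mul_assoc, h1.eq, mul_assoc x, h2, mul_assoc, mul_assoc,
      Unitary.mul_star_self_of_mem (Subtype.property _), mul_one]

end Invariant

/-! ### Isometries of the GNS space -/

section GNSIsometry

variable {d : ℕ} [NeZero d] {ι : Type*} [LinearOrder ι] {φ : PF d ι →ₗ[ℂ] ℂ} (hφ : IsState φ)

/-- The vector `π(x) Ω` of the GNS space. -/
noncomputable def gnsVec : PF d ι →ₗ[ℂ] GNS hφ :=
  (Completion.toComplL : PreGNS hφ →L[ℂ] GNS hφ).toLinearMap ∘ₗ (toPreGNS hφ).toLinearMap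

theorem gnsVec_apply (x : PF d ι) : gnsVec hφ x = ((toPreGNS hφ x : PreGNS hφ) : GNS hφ) := rfl

theorem gnsVec_one : gnsVec hφ 1 = gnsVector hφ := rfl

theorem gnsRep_gnsVec (a x : PF d ι) : gnsRep hφ a (gnsVec hφ x) = gnsVec hφ (a * x) :=
  gnsOp_coe hφ a x

theorem gnsRep_gnsVector (a : PF d ι) : gnsRep hφ a (gnsVector hφ) = gnsVec hφ a := by
  rw [← gnsVec_one, gnsRep_gnsVec, mul_one]

theorem inner_gnsVec (x y : PF d ι) : ⟪gnsVec hφ x, gnsVec hφ y⟫_ℂ = φ (star x * y) := by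
  rw [gnsVec_apply, gnsVec_apply, Completion.inner_coe, preGNS_inner]

theorem denseRange_gnsVec : DenseRange (gnsVec hφ) :=
  Completion.denseRange_coe.comp (toPreGNS hφ).surjective.denseRange
    (Completion.continuous_coe _)

theorem gnsVec_ext {S T : GNS hφ →L[ℂ] GNS hφ} (h : ∀ x, S (gnsVec hφ x) = T (gnsVec hφ x)) :
    S = T := gns_ext hφ h

theorem norm_gnsVec_sq (x : PF d ι) : ((‖gnsVec hφ x‖ ^ 2 : ℝ) : ℂ) = φ (star x * x) := by
  rw [← inner_gnsVec hφ, inner_self_eq_norm_sq_to_K]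
  simp

theorem norm_gnsVector : ‖gnsVector hφ‖ = 1 := by
  have h := norm_gnsVec_sq hφ 1
  rw [star_one, one_mul, hφ.map_one, gnsVec_one] at h
  have h' : ‖gnsVector hφ‖ ^ 2 = 1 := by exact_mod_cast h
  nlinarith [norm_nonneg (gnsVector hφ)]

variable {hφ} in
theorem norm_gnsVec_le_of_isometric {θ : PF d ι →ₗ[ℂ] PF d ι}
    (hθ : ∀ x y, φ (star (θ x) * θ y) = φ (star x * y)) (x : PF d ι) :
    ‖gnsVec hφ (θ x)‖ = ‖gnsVec hφ x‖ := by
  have h : ((‖gnsVec hφ (θ x)‖ ^ 2 : ℝ) : ℂ) = ((‖gnsVec hφ x‖ ^ 2 : ℝ) : ℂ) := by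
    rw [norm_gnsVec_sq, norm_gnsVec_sq, hθ]
  exact (pow_left_inj₀ (norm_nonneg _) (norm_nonneg _) two_ne_zero).1 (by exact_mod_cast h)

/-- The isometry of the GNS space induced by a linear map `θ` of the algebra preserving the
semi-inner product `φ (star x * y)`. -/
noncomputable def gnsIsometry (θ : PF d ι →ₗ[ℂ] PF d ι)
    (hθ : ∀ x y, φ (star (θ x) * θ y) = φ (star x * y)) : GNS hφ →L[ℂ] GNS hφ :=
  (LinearMap.mkContinuous
    ((toPreGNS hφ).toLinearMap ∘ₗ θ ∘ₗ (toPreGNS hφ).symm.toLinearMap) 1 fun x => by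
      obtain ⟨x, rfl⟩ := (toPreGNS hφ).surjective x
      rw [one_mul]
      have h := norm_gnsVec_le_of_isometric (hφ := hφ) hθ x
      rw [gnsVec_apply, gnsVec_apply, Completion.norm_coe, Completion.norm_coe] at h
      exact h.le).completion

variable {θ : PF d ι →ₗ[ℂ] PF d ι} (hθ : ∀ x y, φ (star (θ x) * θ y) = φ (star x * y))

theorem gnsIsometry_gnsVec (x : PF d ι) :
    gnsIsometry hφ θ hθ (gnsVec hφ x) = gnsVec hφ (θ x) := by
  rw [gnsIsometry, gnsVec_apply, ContinuousLinearMap.completion_apply_coe]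
  rfl

theorem norm_gnsIsometry_apply (v : GNS hφ) : ‖gnsIsometry hφ θ hθ v‖ = ‖v‖ := by
  refine (denseRange_gnsVec hφ).induction_on v ?_ fun x => ?_
  · exact isClosed_eq (by fun_prop) (by fun_prop)
  · rw [gnsIsometry_gnsVec, norm_gnsVec_le_of_isometric hθ]

theorem inner_gnsIsometry (v w : GNS hφ) :
    ⟪gnsIsometry hφ θ hθ v, gnsIsometry hφ θ hθ w⟫_ℂ = ⟪v, w⟫_ℂ :=
  LinearIsometry.inner_map_map ⟨(gnsIsometry hφ θ hθ).toLinearMap, norm_gnsIsometry_apply hφ hθ⟩ v w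

/-- Cauchy-Schwarz for a state. -/
theorem IsState.norm_sq_le {d : ℕ} [NeZero d] {ι : Type*} [LinearOrder ι] {φ : PF d ι →ₗ[ℂ] ℂ}
    (hφ : IsState φ) (x : PF d ι) : ((‖φ x‖ ^ 2 : ℝ) : ℂ) ≤ φ (star x * x) := by
  rw [← norm_gnsVec_sq hφ, ← inner_gnsVector hφ, gnsRep_gnsVector]
  have h := norm_inner_le_norm (𝕜 := ℂ) (gnsVector hφ) (gnsVec hφ x)
  rw [norm_gnsVector, one_mul] at h
  exact_mod_cast pow_le_pow_left₀ (norm_nonneg _) h 2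

end GNSIsometry

/-! ### The mean ergodic projection and neutrality -/

section Ergodic

open Filter Topology

variable {d : ℕ} [NeZero d] {φ : PF d ℕ →ₗ[ℂ] ℂ}

/-- The Cesàro mean of the first `N` shifts of an element. -/
noncomputable def shiftAverage (N : ℕ) (x : PF d ℕ) : PF d ℕ :=
  (N : ℂ)⁻¹ • ∑ n ∈ Finset.range N, shift n x

theorem braidInvariantStates.map_shiftAverage (hφ : φ ∈ braidInvariantStates d) {N : ℕ}
    (hN : N ≠ 0) (x : PF d ℕ) : φ (shiftAverage N x) = φ x := by
  rw [shiftAverage, map_smul, map_sum]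
  simp only [braidInvariantStates.map_shift hφ, Finset.sum_const, Finset.card_range,
    nsmul_eq_mul, smul_eq_mul]
  field_simp

theorem exists_shiftIsometry (hs : IsState φ) (hφ : φ ∈ braidInvariantStates d) :
    ∃ V : GNS hs →L[ℂ] GNS hs,
      (∀ y, V (gnsVec hs y) = gnsVec hs (shift 1 y)) ∧ ∀ v, ‖V v‖ = ‖v‖ := by
  let L : PF d ℕ →ₗ[ℂ] PF d ℕ :=
    ((shift 1 : PF d ℕ →⋆ₐ[ℂ] PF d ℕ) : PF d ℕ →ₐ[ℂ] PF d ℕ).toLinearMap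
  have hL : ∀ x, L x = shift 1 x := fun _ => rfl
  have hθ : ∀ x y, φ (star (L x) * L y) = φ (star x * y) := fun x y => by
    rw [hL, hL, ← map_star, ← map_mul, braidInvariantStates.map_shift hφ]
  exact ⟨gnsIsometry hs L hθ, gnsIsometry_gnsVec hs hθ, norm_gnsIsometry_apply hs hθ⟩

/-- The mean ergodic theorem for the double shift. Braid invariance makes the correlations
`φ (star x * shift n y)` eventually constant in `n`, so that they are given exactly by the ergodic
projection. -/
theorem exists_ergodicProjection (hs : IsState φ)
    (hφ : φ ∈ braidInvariantStates d) :
    ∃ P : GNS hs →L[ℂ] GNS hs, IsStarProjection P ∧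
      (∀ x y, ∀ᶠ n in atTop, φ (star x * shift n y) = ⟪gnsVec hs x, P (gnsVec hs y)⟫_ℂ) ∧
      ∀ y, Tendsto (fun N => gnsVec hs (shiftAverage N y)) atTop (𝓝 (P (gnsVec hs y))) := by
  obtain ⟨V, hV0, hVn⟩ := exists_shiftIsometry hs hφ
  have hV : ∀ n y, V^[n] (gnsVec hs y) = gnsVec hs (shift n y) := by
    intro n y
    induction n with
    | zero => rw [shift_zero]; rfl
    | succ n ih =>
      rw [Function.iterate_succ_apply', ih, hV0]
      exact congrArg _ ((shift_shift 1 n y).trans (by rw [add_comm]))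
  have hV1 : ‖V‖ ≤ 1 := V.opNorm_le_bound zero_le_one fun v => by
    rw [one_mul, hVn]
  let K := V.eqLocus (1 : GNS hs →L[ℂ] GNS hs)
  have hlim : ∀ y, Tendsto (fun N => gnsVec hs (shiftAverage N y)) atTop
      (𝓝 (K.starProjection (gnsVec hs y))) := by
    intro y
    refine (V.tendsto_birkhoffAverage_orthogonalProjection hV1 (gnsVec hs y)).congr fun N => ?_
    simp only [birkhoffAverage, birkhoffSum, shiftAverage, map_smul, map_sum, hV, id]
  refine ⟨K.starProjection, isStarProjection_starProjection, fun x y => ?_, hlim⟩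
  obtain ⟨m, hm⟩ := (eventually_mem_braidCommutant (star x)).exists
  have hc : ∀ n ≥ m, φ (star x * shift n y) = φ (star x * shift m y) := fun n hn =>
    braidInvariantStates.mul_shift_eq hφ hn hm y
  have h1 : Tendsto (fun n => φ (star x * shift n y)) atTop (𝓝 (φ (star x * shift m y))) :=
    tendsto_const_nhds.congr' (by
      filter_upwards [eventually_ge_atTop m] with n hn using (hc n hn).symm)
  have h2 := h1.cesaro_smul
  have h3 : Tendsto (fun N => ⟪gnsVec hs x, gnsVec hs (shiftAverage N y)⟫_ℂ) atTop
      (𝓝 ⟪gnsVec hs x, K.starProjection (gnsVec hs y)⟫_ℂ) := tendsto_const_nhds.inner (hlim y)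
  have h4 := tendsto_nhds_unique h3 (h2.congr fun N => by
    rw [inner_gnsVec, shiftAverage, mul_smul_comm, map_smul, Finset.mul_sum, map_sum]
    simp [Complex.real_smul])
  filter_upwards [eventually_ge_atTop m] with n hn
  rw [hc n hn, h4]

theorem qpow_mul_self_ne_one (hd : Squarefree d) {t : ZMod d} (ht : t ≠ 0) :
    qpow (t * t) ≠ 1 := by
  intro h
  have h1 : t * t = 0 := ZMod.injective_stdAddChar (h.trans qpow_zero.symm)
  have : IsReduced (ZMod d) := isReduced_zmod.2 (Or.inl hd)
  exact ht ((pow_eq_zero_iff two_ne_zero).1 (by rw [sq]; exact h1))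

theorem norm_qpow (t : ZMod d) : ‖qpow t‖ = 1 := AddChar.norm_apply _ _

/-- If two nonnegative reals differ by a phase other than `1`, both vanish. -/
theorem eq_zero_of_eq_phase_mul {z : ℂ} (hz : ‖z‖ = 1) (hz1 : z ≠ 1) {r s : ℝ} (hr : 0 ≤ r)
    (hs : 0 ≤ s) (h : (r : ℂ) = z * s) : r = 0 := by
  have h1 := congrArg norm h
  rw [norm_mul, hz, one_mul, Complex.norm_real, Complex.norm_real, Real.norm_of_nonneg hr,
    Real.norm_of_nonneg hs] at h1
  subst h1
  by_contra hr0
  have : ((r : ℂ)) ≠ 0 := by exact_mod_cast hr0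
  exact hz1 (mul_right_cancel₀ this (by rw [one_mul]; exact h.symm))

/-- The correlations of `x` with its shifts and those of `star x` with its shifts are nonnegative
and differ by the phase `q ^ (t * t)`, `t` being the charge. This phase is not `1`, as `d` is
square-free. -/
theorem ergodicProjection_mono_eq_zero (hd : Squarefree d) {hs : IsState φ}
    {P : GNS hs →L[ℂ] GNS hs} (hP : IsStarProjection P)
    (hPc : ∀ x y, ∀ᶠ n in atTop, φ (star x * shift n y) = ⟪gnsVec hs x, P (gnsVec hs y)⟫_ℂ)
    {a : ℕ →₀ ZMod d} (ha : PF.deg a ≠ 0) : P (gnsVec hs (PF.mono a 1)) = 0 := by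
  have hn : ∀ v, ⟪v, P v⟫_ℂ = ((‖P v‖ ^ 2 : ℝ) : ℂ) := fun v => by
    have h1 : P (P v) = P v := congrArg (· v) hP.isIdempotentElem.eq
    have h2 : ⟪P v, P v⟫_ℂ = ⟪v, P v⟫_ℂ := by
      conv_rhs => rw [← h1]
      exact hP.isSelfAdjoint.isSymmetric v (P v)
    rw [← h2, inner_self_eq_norm_sq_to_K]
    simp
  set x : PF d ℕ := PF.mono a 1 with hx
  have h1 := hPc x x
  have h2 := hPc (star x) (star x)
  obtain ⟨n, h1, h2, h3⟩ := (h1.and (h2.and (eventually_mono_mul_shift_mono a))).exists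
  rw [hn] at h1 h2
  have h3' := h3 a
  rw [← hx] at h3'
  -- conjugating the commutation relation of `x` and `shift n x` by `star x`
  have e : star x * shift n x = qpow (-(PF.deg a * PF.deg a)) • (shift n x * star x) := by
    have h4 : star x * (x * shift n x) * star x = star x * (qpow (PF.deg a * PF.deg a) •
      (shift n x * x)) * star x := by rw [h3']
    rw [← mul_assoc, hx, PF.star_mono_mul_mono, one_mul, mul_smul_comm, smul_mul_assoc, ← hx,
      mul_assoc (star x), mul_assoc (shift n x), hx, PF.mono_mul_star_mono, mul_one, ← hx] at h4
    rw [h4, smul_smul, ← qpow_add, neg_add_cancel, qpow_zero, one_smul]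
  have h5 : φ (shift n x * star x) = ((‖P (gnsVec hs (star x))‖ ^ 2 : ℝ) : ℂ) := by
    have := congrArg star h2
    rw [← hs.map_star, star_mul, star_star, map_star, star_star] at this
    rw [this]
    exact Complex.conj_ofReal _
  rw [e, map_smul, h5, smul_eq_mul] at h1
  have h6 := eq_zero_of_eq_phase_mul (norm_qpow _) (fun h => qpow_mul_self_ne_one hd ha (by
    rw [qpow_neg] at h
    rw [← star_star (qpow _), h, star_one])) (sq_nonneg _) (sq_nonneg _) h1.symm
  exact norm_eq_zero.1 (pow_eq_zero_iff two_ne_zero |>.1 h6)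

theorem braidInvariantStates.map_mono_eq_zero (hd : Squarefree d) (hφ : φ ∈ braidInvariantStates d)
    {a : ℕ →₀ ZMod d} (ha : PF.deg a ≠ 0) : φ (PF.mono a 1) = 0 := by
  obtain ⟨P, hP, hPc, -⟩ := exists_ergodicProjection hφ.1 hφ
  obtain ⟨n, hn⟩ := (hPc 1 (PF.mono a 1)).exists
  rw [ergodicProjection_mono_eq_zero hd hP hPc ha, inner_zero_right, star_one, one_mul,
    braidInvariantStates.map_shift hφ] at hn
  exact hn

end Ergodic

/-! ### Membership in the von Neumann algebras of a state -/

section Membership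

variable {H : Type*} [NormedAddCommGroup H] [InnerProductSpace ℂ H] [CompleteSpace H]

theorem mem_vonNeumannGen {S : Set (H →L[ℂ] H)} (hS : ∀ s ∈ S, star s ∈ S) {X : H →L[ℂ] H} :
    X ∈ vonNeumannGen S ↔ ∀ Y, (∀ s ∈ S, Commute s Y) → Commute Y X := by
  change X ∈ StarSubalgebra.centralizer ℂ (StarSubalgebra.centralizer ℂ S : Set (H →L[ℂ] H)) ↔ _
  rw [StarSubalgebra.mem_centralizer_iff]
  have key : ∀ Y, Y ∈ StarSubalgebra.centralizer ℂ S ↔ ∀ s ∈ S, Commute s Y := fun Y => by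
    rw [StarSubalgebra.mem_centralizer_iff]
    exact ⟨fun h s hs => (h s hs).1, fun h s hs => ⟨h s hs, h _ (hS s hs)⟩⟩
  constructor
  · exact fun h Y hY => (h Y ((key Y).2 hY)).1
  · exact fun h Y hY => ⟨h Y ((key Y).1 hY), h _ ((key _).1 (star_mem hY))⟩

variable {d : ℕ} [NeZero d] {φ : PF d ℕ →ₗ[ℂ] ℂ} {hφ : IsState φ}

theorem mem_gnsAlgebra {X : GNS hφ →L[ℂ] GNS hφ} :
    X ∈ gnsAlgebra hφ ↔ ∀ Y, (∀ x, Commute (gnsRep hφ x) Y) → Commute Y X := by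
  refine (mem_vonNeumannGen ?_).trans ?_
  · rintro _ ⟨x, rfl⟩
    exact ⟨star x, map_star _ _⟩
  · simp only [Set.forall_mem_range]

theorem mem_shiftedAlgebra {n : ℕ} {X : GNS hφ →L[ℂ] GNS hφ} :
    X ∈ shiftedAlgebra hφ n ↔
      ∀ Y, (∀ x, Commute (gnsRep hφ (shift n x)) Y) → Commute Y X := by
  refine (mem_vonNeumannGen ?_).trans ?_
  · rintro _ ⟨x, rfl⟩
    refine ⟨star x, ?_⟩
    simp only [doubleShift_iterate, map_star]
  · simp only [Set.forall_mem_range, doubleShift_iterate]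

theorem mem_tailAlgebra {X : GNS hφ →L[ℂ] GNS hφ} :
    X ∈ tailAlgebra hφ ↔
      ∀ n Y, (∀ x, Commute (gnsRep hφ (shift n x)) Y) → Commute Y X := by
  rw [tailAlgebra, StarSubalgebra.mem_iInf]
  exact forall_congr' fun n => mem_shiftedAlgebra

theorem mem_neutralAlgebra_of_commute {X : GNS hφ →L[ℂ] GNS hφ}
    (h : ∀ Y, (∀ a, PF.deg a = 0 → Commute (gnsRep hφ (PF.mono a 1)) Y) → Commute Y X) :
    X ∈ neutralAlgebra hφ := by
  refine (mem_vonNeumannGen ?_).2 fun Y hY => h Y fun a ha => hY _ ⟨_, ?_, rfl⟩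
  · rintro _ ⟨x, hx, rfl⟩
    refine ⟨star x, ?_, map_star _ _⟩
    refine Submodule.span_induction ?_ ?_ ?_ ?_ hx
    · rintro _ ⟨a, ha, rfl⟩
      rw [PF.star_mono, PF.mono_eq_smul]
      refine Submodule.smul_mem _ _ (Submodule.subset_span ⟨-a, ?_, rfl⟩)
      rw [← PF.deg_apply] at ha ⊢
      rw [map_neg, ha, neg_zero]
    · rw [star_zero]; exact zero_mem _
    · intro x y _ _ hx hy
      rw [star_add]; exact add_mem hx hy
    · intro r x _ hx
      rw [star_smul]; exact Submodule.smul_mem _ _ hx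
  · exact Submodule.subset_span ⟨a, ha, rfl⟩

theorem gnsRep_mem (x : PF d ℕ) : gnsRep hφ x ∈ gnsAlgebra hφ :=
  mem_gnsAlgebra.2 fun _ hY => (hY x).symm

theorem mem_commutant_gnsAlgebra {Y : GNS hφ →L[ℂ] GNS hφ} :
    Y ∈ (gnsAlgebra hφ).commutant ↔ ∀ x, Commute (gnsRep hφ x) Y := by
  rw [VonNeumannAlgebra.mem_commutant_iff]
  exact ⟨fun h x => h _ (gnsRep_mem x), fun h X hX => (mem_gnsAlgebra.1 hX Y h).symm⟩

theorem commute_gnsRep_of_commute_c {Y : GNS hφ →L[ℂ] GNS hφ}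
    (h : ∀ j, Commute (gnsRep hφ (PF.c j)) Y) (x : PF d ℕ) : Commute (gnsRep hφ x) Y := by
  have hS : (Subalgebra.centralizer ℂ {Y}).comap
      ((gnsRep hφ : PF d ℕ →⋆ₐ[ℂ] _) : PF d ℕ →ₐ[ℂ] _) = ⊤ :=
    PF.eq_top_of_c_mem fun j => by
      rw [Subalgebra.mem_comap, Subalgebra.mem_centralizer_iff]
      rintro _ rfl
      exact (h j).symm
  have hx : x ∈ (Subalgebra.centralizer ℂ {Y}).comap
      ((gnsRep hφ : PF d ℕ →⋆ₐ[ℂ] _) : PF d ℕ →ₐ[ℂ] _) := hS ▸ Algebra.mem_top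
  rw [Subalgebra.mem_comap, Subalgebra.mem_centralizer_iff] at hx
  exact (hx Y rfl).symm

theorem tailAlgebra_le_gnsAlgebra {X : GNS hφ →L[ℂ] GNS hφ} (hX : X ∈ tailAlgebra hφ) :
    X ∈ gnsAlgebra hφ :=
  mem_gnsAlgebra.2 fun Y hY => mem_tailAlgebra.1 hX 0 Y fun _ => hY _

/-- The vector `Ω` is separating for the commutant. -/
theorem eq_zero_of_gnsVector {X : GNS hφ →L[ℂ] GNS hφ} (hX : ∀ x, Commute (gnsRep hφ x) X)
    (h : X (gnsVector hφ) = 0) : X = 0 := by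
  refine gnsVec_ext hφ fun x => ?_
  have h1 := congrArg (· (gnsVector hφ)) (hX x).eq
  simp only [mul_apply_eq_comp] at h1
  rw [← gnsRep_gnsVector, ← h1, h]
  simp

end Membership

/-! ### The charge rotation and the tail algebra -/

section Charge

variable {d : ℕ} [NeZero d] {φ : PF d ℕ →ₗ[ℂ] ℂ} {hφ : IsState φ}

/-- The linear map multiplying the elements of charge `t` by `q ^ (k * t)`. -/
noncomputable def chargeRotation (d : ℕ) [NeZero d] (k : ZMod d) : PF d ℕ →ₗ[ℂ] PF d ℕ :=
  PF.ofBasis fun a => PF.mono a (qpow (k * PF.deg a))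

theorem chargeRotation_mono (k : ZMod d) (a : ℕ →₀ ZMod d) (s : ℂ) :
    chargeRotation d k (PF.mono a s) = qpow (k * PF.deg a) • PF.mono a s := by
  rw [chargeRotation, PF.ofBasis_mono, PF.smul_mono, PF.smul_mono, mul_comm]

theorem chargeRotation_mono_mul (k : ZMod d) (a : ℕ →₀ ZMod d) (x : PF d ℕ) :
    chargeRotation d k (PF.mono a 1 * x) =
      qpow (k * PF.deg a) • (PF.mono a 1 * chargeRotation d k x) := by
  induction x using PF.induction_mono with
  | zero => simp
  | add x y hx hy => simp only [mul_add, map_add, hx, hy, smul_add]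
  | mono b s =>
    rw [PF.mono_mul_mono, chargeRotation_mono, chargeRotation_mono, mul_smul_comm, smul_smul,
      PF.mono_mul_mono, map_add, mul_add, qpow_add]

theorem chargeRotation_isometric (h0 : ∀ a : ℕ →₀ ZMod d, PF.deg a ≠ 0 → φ (PF.mono a 1) = 0)
    (k : ZMod d) (x y : PF d ℕ) :
    φ (star (chargeRotation d k x) * chargeRotation d k y) = φ (star x * y) := by
  induction x using PF.induction_mono with
  | zero => simp
  | add x x' h h' => simp only [map_add, star_add, add_mul, h, h']
  | mono a s =>
    induction y using PF.induction_mono with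
    | zero => simp
    | add y y' h h' => simp only [map_add, mul_add, h, h']
    | mono b t =>
      rw [chargeRotation_mono, chargeRotation_mono, star_smul, smul_mul_smul_comm, map_smul,
        PF.star_mono, PF.mono_mul_mono, PF.mono_eq_smul, map_smul, ← qpow_neg, ← qpow_add]
      by_cases h : PF.deg (-a + b) = 0
      · have h1 : PF.deg a = PF.deg b := by
          rw [map_add, map_neg] at h
          exact neg_add_eq_zero.1 h
        rw [h1, neg_add_cancel, qpow_zero, one_smul]
      · rw [h0 _ h, smul_zero, smul_zero]

/-- A neutral state has a unitary representation of `ZMod d` on its GNS space which implements the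
grading by the charge. -/
theorem exists_chargeUnitary (hφ : IsState φ)
    (h0 : ∀ a : ℕ →₀ ZMod d, PF.deg a ≠ 0 → φ (PF.mono a 1) = 0) :
    ∃ U : ZMod d → GNS hφ →L[ℂ] GNS hφ, U 0 = 1 ∧ (∀ k l, U k * U l = U (k + l)) ∧
      (∀ k, star (U k) = U (-k)) ∧ ∀ k a, U k * gnsRep hφ (PF.mono a 1) =
        qpow (k * PF.deg a) • (gnsRep hφ (PF.mono a 1) * U k) := by
  let U : ZMod d → GNS hφ →L[ℂ] GNS hφ := fun k =>
    gnsIsometry hφ (chargeRotation d k) (chargeRotation_isometric h0 k)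
  have hU : ∀ k x, U k (gnsVec hφ x) = gnsVec hφ (chargeRotation d k x) := fun k x =>
    gnsIsometry_gnsVec hφ _ x
  have e0 : chargeRotation d 0 = LinearMap.id := PF.linearMap_ext fun a => by
    rw [chargeRotation_mono, zero_mul, qpow_zero, one_smul, LinearMap.id_apply]
  have e1 : ∀ k l, chargeRotation d k ∘ₗ chargeRotation d l = chargeRotation d (k + l) :=
    fun k l => PF.linearMap_ext fun a => by
      rw [LinearMap.comp_apply, chargeRotation_mono, map_smul, chargeRotation_mono,
        chargeRotation_mono, smul_smul, ← qpow_add, add_mul, add_comm]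
  have h1 : U 0 = 1 := gnsVec_ext hφ fun x => by
    rw [hU, e0]; rfl
  have h2 : ∀ k l, U k * U l = U (k + l) := fun k l => gnsVec_ext hφ fun x => by
    rw [mul_apply_eq_comp, hU, hU, hU, ← e1, LinearMap.comp_apply]
  refine ⟨U, h1, h2, fun k => ?_, fun k a => ?_⟩
  · symm
    rw [ContinuousLinearMap.star_eq_adjoint, ContinuousLinearMap.eq_adjoint_iff]
    intro v w
    have h3 : U k (U (-k) v) = v := by
      rw [← mul_apply_eq_comp, h2, add_neg_cancel, h1]; rfl
    conv_rhs => rw [← h3]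
    exact (inner_gnsIsometry hφ (chargeRotation_isometric h0 k) _ _).symm
  · refine gnsVec_ext hφ fun x => ?_
    rw [mul_apply_eq_comp, gnsRep_gnsVec, hU, chargeRotation_mono_mul, map_smul]
    change _ = qpow _ • (gnsRep hφ (PF.mono a 1) (U k (gnsVec hφ x)))
    rw [hU, gnsRep_gnsVec]

/-- The spectral components of an operator under the adjoint action of a representation of `ZMod d`,
up to the normalising factor `d⁻¹`. -/
noncomputable def spectralPart {H : Type*} [NormedAddCommGroup H] [InnerProductSpace ℂ H]
    (U : ZMod d → H →L[ℂ] H) (X : H →L[ℂ] H) (a : ZMod d) : H →L[ℂ] H :=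
  ∑ k, qpow (-(a * k)) • (U k * X * U (-k))

section SpectralPart

variable {H : Type*} [NormedAddCommGroup H] [InnerProductSpace ℂ H] {U : ZMod d → H →L[ℂ] H}

theorem sum_spectralPart (h0 : U 0 = 1) (X : H →L[ℂ] H) :
    ∑ a, spectralPart U X a = (d : ℂ) • X := by
  unfold spectralPart
  rw [Finset.sum_comm]
  have h : ∀ k : ZMod d, ∑ a : ZMod d, qpow (-(a * k)) • (U k * X * U (-k)) =
      if k = 0 then (d : ℂ) • X else 0 := by
    intro k
    rw [← Finset.sum_smul]
    have h1 : ∀ a : ZMod d, -(a * k) = a * (-k) := fun a => by ring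
    simp only [h1, sum_qpow, neg_eq_zero]
    split_ifs with hk
    · subst hk
      rw [neg_zero, h0, one_mul, mul_one]
    · rw [zero_smul]
  simp [h]

theorem mul_spectralPart (hU : ∀ k l, U k * U l = U (k + l)) (X : H →L[ℂ] H) (a l : ZMod d) :
    U l * spectralPart U X a = qpow (a * l) • (spectralPart U X a * U l) := by
  unfold spectralPart
  rw [Finset.mul_sum, Finset.sum_mul, Finset.smul_sum]
  refine Fintype.sum_equiv (Equiv.addLeft l) _ _ fun k => ?_
  rw [Equiv.coe_addLeft, mul_smul_comm, smul_mul_assoc, smul_smul, ← qpow_add, mul_assoc _ _ (U l),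
    hU, ← mul_assoc, ← mul_assoc, hU]
  congr 2
  · ring
  · rw [show -(l + k) + l = -k by abel]

/-- An operator commuting with `X` and rotated by a character commutes with the spectral parts. -/
theorem commute_spectralPart {X D : H →L[ℂ] H} (hD : ∀ k, U k * D = qpow k • (D * U k))
    (h : Commute D X) (a : ZMod d) : Commute D (spectralPart U X a) := by
  refine Commute.sum_right _ _ _ fun k _ => Commute.smul_right ?_ _
  have h1 : D * U k = qpow (-k) • (U k * D) := by
    rw [hD, smul_smul, ← qpow_add, neg_add_cancel, qpow_zero, one_smul]
  change D * (U k * X * U (-k)) = U k * X * U (-k) * D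
  rw [mul_assoc _ _ D, hD, ← mul_assoc, ← mul_assoc, h1, smul_mul_assoc, smul_mul_assoc,
    mul_smul_comm, mul_assoc (U k), h.eq]
  simp only [mul_assoc]

end SpectralPart

/-- The tail algebra is central. Elements of the tail commute with `π (c j) * U (-1)`, so their
spectral part `X` of weight `a` under the charge rotations is such that `X * U a` lies in the
commutant. Comparing with `star X` gives `star X * X = q ^ (-a * a) • (X * star X)`, and `X = 0` for
`a ≠ 0` by positivity. -/
theorem commute_of_mem_tailAlgebra (hd : Squarefree d)
    (h0 : ∀ a : ℕ →₀ ZMod d, PF.deg a ≠ 0 → φ (PF.mono a 1) = 0) {X : GNS hφ →L[ℂ] GNS hφ}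
    (hX : X ∈ tailAlgebra hφ) (x : PF d ℕ) : Commute (gnsRep hφ x) X := by
  obtain ⟨U, hU0, hU, hUs, hUm⟩ := exists_chargeUnitary hφ h0
  have hUc : ∀ k j, U k * gnsRep hφ (PF.c j) = qpow k • (gnsRep hφ (PF.c j) * U k) := fun k j => by
    rw [PF.c, hUm, PF.deg_single, mul_one]
  have hinv : ∀ k, U k * U (-k) = 1 := fun k => by rw [hU, add_neg_cancel, hU0]
  have hD : ∀ j, Commute (gnsRep hφ (PF.c j) * U (-1)) X := by
    intro j
    obtain ⟨n, hn⟩ := (eventually_mono_mul_shift_mono (d := d) (Finsupp.single j 1)).exists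
    refine mem_tailAlgebra.1 hX n _ fun y => ?_
    induction y using PF.induction_mono with
    | zero => rw [map_zero, map_zero]; exact Commute.zero_left _
    | add y y' h h' => rw [map_add, map_add]; exact h.add_left h'
    | mono b s =>
      rw [PF.mono_eq_smul, map_smul, map_smul]
      refine Commute.smul_left ?_ _
      have h1 := congrArg (gnsRep hφ) (hn b)
      rw [map_mul, map_smul, map_mul, PF.deg_single, one_mul] at h1
      have h2 := hUm (-1) (b.mapDomain (· + 2 * n))
      rw [← shift_mono, PF.deg_mapDomain, neg_one_mul] at h2
      change _ * (gnsRep hφ (PF.mono _ 1) * U (-1)) = gnsRep hφ (PF.mono _ 1) * U (-1) * _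
      rw [mul_assoc _ (U (-1)), h2, mul_smul_comm, ← mul_assoc, ← mul_assoc, h1, smul_mul_assoc,
        smul_smul, ← qpow_add, neg_add_cancel, qpow_zero, one_smul]
  have hDU : ∀ j k, U k * (gnsRep hφ (PF.c j) * U (-1)) =
      qpow k • (gnsRep hφ (PF.c j) * U (-1) * U k) := fun j k => by
    rw [← mul_assoc, hUc, smul_mul_assoc, mul_assoc, mul_assoc, hU, hU, add_comm]
  -- the spectral parts commute with the generators up to a phase
  have hc : ∀ a j, spectralPart U X a * gnsRep hφ (PF.c j) =
      qpow (-a) • (gnsRep hφ (PF.c j) * spectralPart U X a) := by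
    intro a j
    have h1 := commute_spectralPart (hDU j) (hD j) a
    have h2 := congrArg (· * U 1) h1.eq
    simp only [mul_assoc, hU, neg_add_cancel, hU0, mul_one] at h2
    rw [← h2, ← mul_assoc (U (-1)), mul_spectralPart hU, mul_neg_one, smul_mul_assoc,
      mul_assoc (spectralPart U X a), hU, neg_add_cancel, hU0, mul_one, mul_smul_comm]
  have hW : ∀ a x, Commute (gnsRep hφ x) (spectralPart U X a * U a) := fun a =>
    commute_gnsRep_of_commute_c fun j => by
      change _ = _
      rw [mul_assoc, hUc, mul_smul_comm, ← mul_assoc, ← mul_assoc, hc, smul_mul_assoc, smul_smul,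
        ← qpow_add, add_neg_cancel, qpow_zero, one_smul]
  have hM : ∀ a, spectralPart U X a ∈ gnsAlgebra hφ := by
    refine fun a => mem_gnsAlgebra.2 fun Y hY => ?_
    refine Commute.sum_right _ _ _ fun k _ => Commute.smul_right ?_ _
    have h1 : ∀ x, Commute (gnsRep hφ x) (U (-k) * Y * U k) :=
      commute_gnsRep_of_commute_c fun j => by
        have h2 : gnsRep hφ (PF.c j) * U (-k) = qpow k • (U (-k) * gnsRep hφ (PF.c j)) := by
          rw [hUc, smul_smul, ← qpow_add, add_neg_cancel, qpow_zero, one_smul]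
        calc gnsRep hφ (PF.c j) * (U (-k) * Y * U k)
            = gnsRep hφ (PF.c j) * U (-k) * Y * U k := by simp only [mul_assoc]
          _ = qpow k • (U (-k) * (gnsRep hφ (PF.c j) * Y) * U k) := by
            rw [h2]; simp only [smul_mul_assoc, mul_assoc]
          _ = U (-k) * Y * (qpow k • (gnsRep hφ (PF.c j) * U k)) := by
            rw [(hY _).eq]; simp only [mul_smul_comm, mul_assoc]
          _ = U (-k) * Y * U k * gnsRep hφ (PF.c j) := by rw [← hUc]; simp only [mul_assoc]
    have h2 := (mem_gnsAlgebra.1 (tailAlgebra_le_gnsAlgebra hX) _ h1).eq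
    have h3 := congrArg (fun T => U k * T * U (-k)) h2
    simp only [mul_assoc, hinv, mul_one] at h3
    rw [← mul_assoc (U k) (U (-k)), hinv, one_mul] at h3
    change _ = _
    rw [mul_assoc, mul_assoc, mul_assoc, h3]
  have hz : ∀ a, a ≠ 0 → spectralPart U X a = 0 := by
    intro a ha
    set Z := spectralPart U X a with hZ
    have h1 : star Z * Z * U a = Z * U a * star Z := by
      rw [mul_assoc]
      exact (mem_gnsAlgebra.1 (star_mem (hM a)) _ (hW a)).eq.symm
    have h2 := congrArg star (mul_spectralPart hU X a (-a))
    rw [← hZ, star_smul, star_mul, star_mul, hUs, neg_neg, mul_neg, qpow_neg, star_star] at h2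
    have h3 : U a * star Z = qpow (-(a * a)) • (star Z * U a) := by
      rw [h2, smul_smul, ← qpow_add, neg_add_cancel, qpow_zero, one_smul]
    rw [mul_assoc Z, h3, mul_smul_comm, ← mul_assoc] at h1
    have h4 := congrArg (· * U (-a)) h1
    simp only [smul_mul_assoc, mul_assoc _ _ (U (-a)), hinv, mul_one] at h4
    ext v
    have h5 : ((‖Z v‖ ^ 2 : ℝ) : ℂ) = qpow (-(a * a)) * ((‖star Z v‖ ^ 2 : ℝ) : ℂ) := by
      have h6 : ⟪v, (star Z * Z) v⟫_ℂ = ⟪v, (qpow (-(a * a)) • (Z * star Z)) v⟫_ℂ := by rw [h4]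
      have h7 : ⟪v, (star Z * Z) v⟫_ℂ = ((‖Z v‖ ^ 2 : ℝ) : ℂ) := by
        rw [mul_apply_eq_comp, ContinuousLinearMap.star_eq_adjoint,
          ContinuousLinearMap.adjoint_inner_right, inner_self_eq_norm_sq_to_K]
        simp
      have h8 : ⟪v, (Z * star Z) v⟫_ℂ = ((‖star Z v‖ ^ 2 : ℝ) : ℂ) := by
        rw [mul_apply_eq_comp, ← ContinuousLinearMap.adjoint_inner_left,
          ← ContinuousLinearMap.star_eq_adjoint, inner_self_eq_norm_sq_to_K]
        simp
      rw [← h7, h6, ← h8]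
      exact inner_smul_right _ _ _
    have h9 := eq_zero_of_eq_phase_mul (norm_qpow _) (fun h => qpow_mul_self_ne_one hd ha (by
      rw [qpow_neg] at h
      rw [← star_star (qpow _), h, star_one])) (sq_nonneg _) (sq_nonneg _) h5
    exact norm_eq_zero.1 (pow_eq_zero_iff two_ne_zero |>.1 h9)
  have hX0 : (d : ℂ) • X = spectralPart U X 0 := by
    rw [← sum_spectralPart hU0 X]
    exact Finset.sum_eq_single 0 (fun a _ ha => hz a ha) fun h => (h (Finset.mem_univ _)).elim
  refine commute_gnsRep_of_commute_c (fun j => ?_) x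
  have h1 := hc 0 j
  rw [neg_zero, qpow_zero, one_smul, ← hX0, smul_mul_assoc, mul_smul_comm] at h1
  exact (smul_right_injective _ (Nat.cast_ne_zero.2 (NeZero.ne d)) h1).symm

end Charge

/-! ### Product states and clustering -/

section Clustering

open Filter Topology

/-- A bounded sequence of operators has a limit along an ultrafilter in the weak operator
topology. -/
theorem exists_weakLimit {H : Type*} [NormedAddCommGroup H] [InnerProductSpace ℂ H]
    [CompleteSpace H] (F : Ultrafilter ℕ) (T : ℕ → H →L[ℂ] H) {C : ℝ} (hT : ∀ n, ‖T n‖ ≤ C) :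
    ∃ Y : H →L[ℂ] H, ∀ v w, Tendsto (fun n => ⟪v, T n w⟫_ℂ) F (𝓝 ⟪v, Y w⟫_ℂ) := by
  have hb : ∀ v w n, ‖⟪v, T n w⟫_ℂ‖ ≤ C * ‖v‖ * ‖w‖ := fun v w n => by
    refine (norm_inner_le_norm _ _).trans ?_
    calc ‖v‖ * ‖T n w‖ ≤ ‖v‖ * (C * ‖w‖) := by gcongr; exact (T n).le_of_opNorm_le (hT n) w
      _ = C * ‖v‖ * ‖w‖ := by ring
  have hL : ∀ v w, ∃ z : ℂ, ‖z‖ ≤ C * ‖v‖ * ‖w‖ ∧ Tendsto (fun n => ⟪v, T n w⟫_ℂ) F (𝓝 z) := by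
    intro v w
    obtain ⟨z, hz, h⟩ := (isCompact_closedBall (0 : ℂ) (C * ‖v‖ * ‖w‖)).ultrafilter_le_nhds
      (F.map fun n => ⟪v, T n w⟫_ℂ) (by
        rw [le_principal_iff]
        exact Filter.mem_map.2 (Filter.univ_mem' fun n => mem_closedBall_zero_iff.2 (hb v w n)))
    exact ⟨z, mem_closedBall_zero_iff.1 hz, h⟩
  choose L hL1 hL2 using hL
  let B : H →L⋆[ℂ] H →L[ℂ] ℂ := LinearMap.mkContinuous₂ (LinearMap.mk₂'ₛₗ _ _ L
    (fun v v' w => tendsto_nhds_unique (hL2 _ _) (by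
      simpa only [inner_add_left] using (hL2 v w).add (hL2 v' w)))
    (fun r v w => tendsto_nhds_unique (hL2 _ _) (by
      simpa only [inner_smul_left, smul_eq_mul] using (hL2 v w).const_mul _))
    (fun v w w' => tendsto_nhds_unique (hL2 _ _) (by
      simpa only [map_add, inner_add_right] using (hL2 v w).add (hL2 v w')))
    (fun r v w => tendsto_nhds_unique (hL2 _ _) (by
      simpa only [map_smul, inner_smul_right, smul_eq_mul, RingHom.id_apply] using
        (hL2 v w).const_mul _))) C hL1
  refine ⟨ContinuousLinearMap.adjoint (InnerProductSpace.continuousLinearMapOfBilin B),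
    fun v w => ?_⟩
  rw [ContinuousLinearMap.adjoint_inner_right, InnerProductSpace.continuousLinearMapOfBilin_apply]
  exact hL2 v w

theorem commute_weakLimit {H : Type*} [NormedAddCommGroup H] [InnerProductSpace ℂ H]
    [CompleteSpace H] {F : Ultrafilter ℕ} {T : ℕ → H →L[ℂ] H} {Y Z : H →L[ℂ] H}
    (hY : ∀ v w, Tendsto (fun n => ⟪v, T n w⟫_ℂ) F (𝓝 ⟪v, Y w⟫_ℂ))
    (h : ∀ᶠ n in F, Commute Z (T n)) : Commute Z Y := by
  change Z * Y = Y * Z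
  ext w
  refine ext_inner_left ℂ fun v => ?_
  rw [mul_apply_eq_comp, mul_apply_eq_comp, ← ContinuousLinearMap.adjoint_inner_left]
  refine tendsto_nhds_unique (hY _ _) ((hY v (Z w)).congr' ?_)
  filter_upwards [h] with n hn
  rw [ContinuousLinearMap.adjoint_inner_left, ← mul_apply_eq_comp, ← mul_apply_eq_comp, hn.eq]

variable {d : ℕ} [NeZero d] {φ : PF d ℕ →ₗ[ℂ] ℂ}

theorem norm_gnsRep_mono_le (hs : IsState φ) (a : ℕ →₀ ZMod d) :
    ‖gnsRep hs (PF.mono a 1)‖ ≤ 1 := by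
  have h : ‖gnsRep hs (PF.mono a 1)‖ * ‖gnsRep hs (PF.mono a 1)‖ ≤ 1 := by
    rw [← CStarRing.norm_star_mul_self, ← map_star, ← map_mul, PF.star_mono_mul_mono, map_one]
    exact ContinuousLinearMap.norm_id_le
  nlinarith [norm_nonneg (gnsRep hs (PF.mono a 1))]

/-- The factorisation of correlations with far enough shifts. -/
def IsClustering (φ : PF d ℕ →ₗ[ℂ] ℂ) : Prop :=
  ∀ x y, ∀ᶠ n in atTop, φ (x * shift n y) = φ x * φ y

/-- If the neutral part of the tail algebra is trivial, the state is clustering: for a neutral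
monomial `y`, a weak limit of the shifts of `π y` lies in the neutral tail algebra, hence is a
scalar; for a charged one, both sides vanish. -/
theorem isClustering_of_neutralTailAlgebra_eq_bot (hd : Squarefree d) (hs : IsState φ)
    (hφ : φ ∈ braidInvariantStates d) (h : neutralTailAlgebra hs = ⊥) : IsClustering φ := by
  obtain ⟨P, hP, hPc, -⟩ := exists_ergodicProjection hs hφ
  have key : ∀ x b, ∀ᶠ n in atTop, φ (x * shift n (PF.mono b 1)) = φ x * φ (PF.mono b 1) := by
    intro x b
    by_cases hb : PF.deg b = 0
    · obtain ⟨Y, hY⟩ := exists_weakLimit (hyperfilter ℕ)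
        (fun n => gnsRep hs (shift n (PF.mono b 1))) (C := 1) fun n => by
          rw [shift_mono]; exact norm_gnsRep_mono_le hs _
      have hY1 : Y ∈ neutralTailAlgebra hs := by
        refine ⟨mem_tailAlgebra.2 fun m Z hZ => commute_weakLimit hY ?_,
          mem_neutralAlgebra_of_commute fun Z hZ => commute_weakLimit hY ?_⟩
        · filter_upwards [Nat.hyperfilter_le_atTop (eventually_ge_atTop m)] with n hn
          rw [← Nat.add_sub_of_le hn, ← shift_shift]
          exact (hZ _).symm
        · refine Eventually.of_forall fun n => ?_
          rw [shift_mono]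
          exact (hZ _ (by rw [PF.deg_mapDomain, hb])).symm
      rw [h, StarSubalgebra.mem_bot] at hY1
      obtain ⟨r, rfl⟩ := hY1
      have h1 : ∀ x, (fun n => φ (x * shift n (PF.mono b 1))) =ᶠ[atTop] fun _ => r * φ x := by
        intro x
        obtain ⟨m, hm⟩ := (eventually_mem_braidCommutant x).exists
        have h2 := hY (gnsVec hs (star x)) (gnsVector hs)
        have h3 : (fun n => ⟪gnsVec hs (star x),
            gnsRep hs (shift n (PF.mono b 1)) (gnsVector hs)⟫_ℂ) =ᶠ[hyperfilter ℕ]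
              fun _ => φ (x * shift m (PF.mono b 1)) := by
          filter_upwards [Nat.hyperfilter_le_atTop (eventually_ge_atTop m)] with n hn
          rw [gnsRep_gnsVector, inner_gnsVec, star_star, braidInvariantStates.mul_shift_eq hφ hn hm]
        have h4 := tendsto_nhds_unique (h2.congr' h3) tendsto_const_nhds
        have h5 : ⟪gnsVec hs (star x), (algebraMap ℂ (GNS hs →L[ℂ] GNS hs) r) (gnsVector hs)⟫_ℂ =
            r * φ x := by
          rw [Algebra.algebraMap_eq_smul_one]
          refine (inner_smul_right _ _ _).trans ?_
          rw [← gnsVec_one]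
          change r * ⟪gnsVec hs (star x), gnsVec hs 1⟫_ℂ = _
          rw [inner_gnsVec, star_star, mul_one]
        filter_upwards [eventually_ge_atTop m] with n hn
        rw [braidInvariantStates.mul_shift_eq hφ hn hm, ← h4, h5]
      have hr : φ (PF.mono b 1) = r := by
        obtain ⟨n, hn⟩ := (h1 1).exists
        simpa only [one_mul, braidInvariantStates.map_shift hφ, hs.map_one, mul_one] using hn
      filter_upwards [h1 x] with n hn
      rw [hn, hr, mul_comm]
    · filter_upwards [hPc (star x) (PF.mono b 1)] with n hn
      rw [star_star] at hn
      rw [hn, ergodicProjection_mono_eq_zero hd hP hPc hb, inner_zero_right,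
        braidInvariantStates.map_mono_eq_zero hd hφ hb, mul_zero]
  intro x y
  induction y using PF.induction_mono with
  | zero => simp
  | add y y' h h' =>
    filter_upwards [h, h'] with n h h'
    rw [map_add, mul_add, map_add, h, h', map_add, mul_add]
  | mono b s =>
    filter_upwards [key x b] with n hn
    rw [PF.mono_eq_smul, map_smul, mul_smul_comm, map_smul, hn, map_smul, smul_eq_mul, smul_eq_mul]
    ring

theorem IsClustering.mul_shift (hφ : φ ∈ braidInvariantStates d) (h : IsClustering φ) {m : ℕ}
    {x : PF d ℕ} (hx : x ∈ braidCommutant d m) (y : PF d ℕ) :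
    φ (x * shift m y) = φ x * φ y := by
  obtain ⟨n, hn, h⟩ := ((eventually_ge_atTop m).and (h x y)).exists
  rw [← braidInvariantStates.mul_shift_eq hφ hn hx, h]

/-- A clustering state is the infinite product of its restriction to the first pair of strings. -/
theorem isInfiniteProduct_of_isClustering (hd : Squarefree d) (hφ : φ ∈ braidInvariantStates d)
    (h : IsClustering φ) :
    ∃ ρ : PF d (Fin 2) →ₗ[ℂ] ℂ, IsState ρ ∧ IsNeutral ρ ∧ IsInfiniteProduct φ ρ := by
  let f : PF d (Fin 2) →ₗ[ℂ] PF d ℕ := (pairIncl d 0 : PF d (Fin 2) →ₐ[ℂ] PF d ℕ).toLinearMap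
  have hf : ∀ x, f x = pairIncl d 0 x := fun _ => rfl
  refine ⟨φ ∘ₗ f, ⟨?_, fun x => ?_⟩, fun k hk x hx => ?_, fun n => ?_⟩
  · rw [LinearMap.comp_apply, hf, map_one, hφ.1.map_one]
  · rw [LinearMap.comp_apply, hf, map_mul, map_star]
    exact hφ.1.nonneg _
  · refine Submodule.span_induction ?_ (map_zero _) ?_ ?_ hx
    · rintro _ ⟨a, ha, rfl⟩
      rw [LinearMap.comp_apply, hf, pairIncl_mono]
      refine braidInvariantStates.map_mono_eq_zero hd hφ ?_
      rw [PF.deg_mapDomain, PF.deg_apply, ha]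
      exact hk
    · intro x y _ _ hx hy
      rw [map_add, hx, hy, add_zero]
    · intro r x _ hx
      rw [map_smul, hx, smul_zero]
  · induction n with
    | zero => intro x; simpa using hφ.1.map_one
    | succ n ih =>
      intro x
      have e : (List.ofFn fun k : Fin n => pairIncl d (k.succ : Fin (n + 1)) (x k.succ)).prod =
          shift 1 (List.ofFn fun k : Fin n => pairIncl d k (x k.succ)).prod := by
        rw [map_list_prod, List.map_ofFn]
        congr 2
        funext k
        rw [Function.comp_apply, shift_pairIncl, Fin.val_succ, add_comm]
      rw [List.ofFn_succ, List.prod_cons, e, Fin.val_zero,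
        h.mul_shift hφ (pairIncl_mem_braidCommutant one_pos _), Fin.prod_univ_succ, ih]
      rfl

/-- Every monomial is an ordered product of monomials on the pairs of strings. -/
theorem exists_mono_eq_prod (a : ℕ →₀ ZMod d) :
    ∃ (f : ℕ → PF d (Fin 2)) (m : ℕ), ∀ n ≥ m,
      PF.mono a 1 = (List.ofFn fun k : Fin n => pairIncl d k (f k)).prod := by
  have h1 : ∃ (f : ℕ → Fin 2 →₀ ZMod d) (m : ℕ), ∀ n ≥ m,
      a = ∑ k ∈ Finset.range n, (f k).mapDomain fun i : Fin 2 => 2 * k + (i : ℕ) := by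
    induction a using Finsupp.induction_linear with
    | zero => exact ⟨0, 0, fun n _ => by simp⟩
    | add a b ha hb =>
      obtain ⟨f, m, hf⟩ := ha
      obtain ⟨g, n, hg⟩ := hb
      refine ⟨f + g, max m n, fun N hN => ?_⟩
      simp only [Pi.add_apply, Finsupp.mapDomain_add, Finset.sum_add_distrib]
      rw [← hf N (le_of_max_le_left hN), ← hg N (le_of_max_le_right hN)]
    | single j s =>
      refine ⟨Pi.single (j / 2) (Finsupp.single ⟨j % 2, Nat.mod_lt _ two_pos⟩ s), j / 2 + 1,
        fun n hn => ?_⟩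
      rw [Finset.sum_eq_single (j / 2)]
      · rw [Pi.single_eq_same, Finsupp.mapDomain_single, Nat.div_add_mod]
      · intro k _ hk
        rw [Pi.single_eq_of_ne hk, Finsupp.mapDomain_zero]
      · intro h
        exact (h (Finset.mem_range.2 (by omega))).elim
  obtain ⟨f, m, hf⟩ := h1
  refine ⟨fun k => PF.mono (f k) 1, m, fun n hn => ?_⟩
  rw [hf n hn]
  clear hf hn
  induction n with
  | zero => simp [PF.one_def]
  | succ n ih =>
    rw [List.ofFn_succ', List.concat_eq_append, List.prod_append, List.prod_singleton,
      Finset.sum_range_succ]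
    simp only [Fin.val_castSucc, Fin.val_last]
    rw [← ih, pairIncl_mono, PF.mono_mul_mono, PF.cross_eq_zero_of_lt]
    · simp
    · intro j hj k hk
      obtain ⟨l, -, rfl⟩ := Finset.mem_image.1 (Finsupp.mapDomain_support hk)
      obtain ⟨p, hp, hj⟩ := Finset.mem_biUnion.1 (Finsupp.support_finsetSum hj)
      obtain ⟨i, -, rfl⟩ := Finset.mem_image.1 (Finsupp.mapDomain_support hj)
      have := Finset.mem_range.1 hp
      have := i.2
      omega

theorem isClustering_of_isInfiniteProduct {ρ : PF d (Fin 2) →ₗ[ℂ] ℂ}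
    (h : IsInfiniteProduct φ ρ) : IsClustering φ := by
  have key : ∀ a b, ∀ᶠ n in atTop, φ (PF.mono a 1 * shift n (PF.mono b 1)) =
      φ (PF.mono a 1) * φ (PF.mono b 1) := by
    intro a b
    obtain ⟨f, m, hf⟩ := exists_mono_eq_prod a
    obtain ⟨g, l, hg⟩ := exists_mono_eq_prod b
    filter_upwards [eventually_ge_atTop m] with n hn
    rw [hf n hn, hg l le_rfl, h, h, map_list_prod, List.map_ofFn, ← List.prod_append,
      ← List.ofFn_fin_append]
    have e := h (n + l) (Fin.append (fun k : Fin n => f k) (fun k : Fin l => g k))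
    rw [Fin.prod_univ_add] at e
    simp only [Fin.append_left, Fin.append_right] at e
    rw [← e]
    congr 3
    funext k
    refine Fin.addCases (fun i => ?_) (fun i => ?_) k
    · simp
    · simp [shift_pairIncl]
  intro x y
  induction x using PF.induction_mono with
  | zero => simp
  | add x x' h h' =>
    filter_upwards [h, h'] with n h h'
    rw [add_mul, map_add, h, h', map_add, add_mul]
  | mono a s =>
    induction y using PF.induction_mono with
    | zero => simp
    | add y y' h h' =>
      filter_upwards [h, h'] with n h h'
      rw [map_add, mul_add, map_add, h, h', map_add, mul_add]
    | mono b t =>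
      filter_upwards [key a b] with n hn
      rw [PF.mono_eq_smul a, PF.mono_eq_smul b, map_smul, smul_mul_smul_comm, map_smul, hn,
        map_smul, map_smul, smul_eq_mul, smul_eq_mul, smul_eq_mul]
      ring

/-- A clustering state is extreme: ergodic means `A` of an element with `φ x = 0` satisfy
`A Ω → 0`, hence `ψ A → 0` for every invariant `ψ ≤ C φ`, while `ψ A = ψ x`. -/
theorem mem_extremePoints_of_isClustering (hφ : φ ∈ braidInvariantStates d)
    (h : IsClustering φ) : φ ∈ Set.extremePoints ℝ (braidInvariantStates d) := by
  refine ⟨hφ, fun ψ hψ ψ' hψ' hseg => ?_⟩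
  obtain ⟨s, t, hs, ht, -, e⟩ := hseg
  obtain ⟨P, hP, hPc, hPl⟩ := exists_ergodicProjection hφ.1 hφ
  have hle : ∀ x, ψ (star x * x) ≤ ((s⁻¹ : ℝ) : ℂ) * φ (star x * x) := by
    intro x
    have h1 : φ (star x * x) = (s : ℂ) * ψ (star x * x) + (t : ℂ) * ψ' (star x * x) := by
      rw [← e]; rfl
    have h2 : 0 ≤ (t : ℂ) * ψ' (star x * x) :=
      mul_nonneg (by exact_mod_cast ht.le) (hψ'.1.nonneg x)
    have hs0 : (s : ℂ) ≠ 0 := by exact_mod_cast hs.ne'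
    have h3 : 0 ≤ ((s⁻¹ : ℝ) : ℂ) := by exact_mod_cast (inv_pos.2 hs).le
    calc ψ (star x * x) = ((s⁻¹ : ℝ) : ℂ) * ((s : ℂ) * ψ (star x * x)) := by
          rw [Complex.ofReal_inv, inv_mul_cancel_left₀ hs0]
      _ ≤ _ := by
        rw [h1]
        exact mul_le_mul_of_nonneg_left (le_add_of_nonneg_right h2) h3
  have h0 : ∀ x, φ x = 0 → ψ x = 0 := by
    intro x hx
    have hPx : P (gnsVec hφ.1 x) = 0 := by
      refine (denseRange_gnsVec hφ.1).eq_zero_of_inner_right (𝕜 := ℂ) fun y => ?_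
      obtain ⟨n, h1, h2⟩ := ((hPc y x).and (h (star y) x)).exists
      rw [← h1, h2, hx, mul_zero]
    have h1 := hPl x
    rw [hPx] at h1
    have h2 : Tendsto (fun N => s⁻¹ * ‖gnsVec hφ.1 (shiftAverage N x)‖ ^ 2) atTop (𝓝 0) := by
      simpa using (h1.norm.pow 2).const_mul s⁻¹
    have h3 : ∀ᶠ N in atTop, ‖ψ x‖ ^ 2 ≤ s⁻¹ * ‖gnsVec hφ.1 (shiftAverage N x)‖ ^ 2 := by
      filter_upwards [eventually_ne_atTop 0] with N hN
      have h4 := (hψ.1.norm_sq_le (shiftAverage N x)).trans (hle _)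
      rw [braidInvariantStates.map_shiftAverage hψ hN, ← norm_gnsVec_sq hφ.1] at h4
      exact_mod_cast h4
    have h5 := ge_of_tendsto h2 h3
    exact norm_eq_zero.1 (pow_eq_zero_iff two_ne_zero |>.1 (le_antisymm h5 (sq_nonneg _)))
  ext x
  have h1 := h0 (x - φ x • 1) (by rw [map_sub, map_smul, hφ.1.map_one]; simp)
  rw [map_sub, map_smul, hψ.1.map_one, smul_eq_mul, mul_one, sub_eq_zero] at h1
  exact h1

end Clustering

/-! ### Central elements of braid-invariant states -/

section BraidUnitary

variable {d : ℕ} [NeZero d] {φ : PF d ℕ →ₗ[ℂ] ℂ}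

/-- The adjoint action of a braid is implemented on the GNS space by an isometry fixing `Ω`, which
differs from `π b` by the element `x Ω ↦ x (star b) Ω` of the commutant. -/
theorem exists_braidIsometry (hs : IsState φ) (hφ : φ ∈ braidInvariantStates d)
    {b : unitary (PF d ℕ)} (hb : b ∈ braidGroup d) :
    ∃ V : GNS hs →L[ℂ] GNS hs,
      (∀ x, V (gnsVec hs x) = gnsVec hs ((b : PF d ℕ) * x * star (b : PF d ℕ))) ∧
      (∀ v w, ⟪V v, V w⟫_ℂ = ⟪v, w⟫_ℂ) ∧
      ∀ X ∈ gnsAlgebra hs, V * X = gnsRep hs b * X * star (gnsRep hs b) * V := by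
  have h1 : star (b : PF d ℕ) * b = 1 := Unitary.star_mul_self_of_mem b.2
  let L : PF d ℕ →ₗ[ℂ] PF d ℕ := LinearMap.mulRight ℂ (star (b : PF d ℕ))
  have hL : ∀ x, L x = x * star (b : PF d ℕ) := fun _ => rfl
  have hθ : ∀ x y, φ (star (L x) * L y) = φ (star x * y) := fun x y => by
    rw [hL, hL, star_mul, star_star, mul_assoc, ← mul_assoc (star x), ← mul_assoc, hφ.2 b hb]
  obtain ⟨R, hR, hRi⟩ : ∃ R : GNS hs →L[ℂ] GNS hs,
      (∀ x, R (gnsVec hs x) = gnsVec hs (x * star (b : PF d ℕ))) ∧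
      ∀ v w, ⟪R v, R w⟫_ℂ = ⟪v, w⟫_ℂ :=
    ⟨gnsIsometry hs L hθ, gnsIsometry_gnsVec hs hθ, inner_gnsIsometry hs hθ⟩
  have hRc : ∀ x, Commute (gnsRep hs x) R := fun x => gnsVec_ext hs fun y => by
    rw [mul_apply_eq_comp, mul_apply_eq_comp, hR, gnsRep_gnsVec, gnsRep_gnsVec, hR, mul_assoc]
  have hu : star (gnsRep hs b) * gnsRep hs b = 1 := by
    rw [← map_star, ← map_mul, h1, map_one]
  refine ⟨gnsRep hs b * R, fun x => ?_, fun v w => ?_, fun X hX => ?_⟩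
  · rw [mul_apply_eq_comp, hR, gnsRep_gnsVec, mul_assoc]
  · rw [mul_apply_eq_comp, mul_apply_eq_comp, ← ContinuousLinearMap.adjoint_inner_right,
      ← ContinuousLinearMap.star_eq_adjoint, ← mul_apply_eq_comp (star _), hu]
    exact hRi v w
  · rw [mul_assoc _ R, (mem_gnsAlgebra.1 hX R hRc).eq, mul_assoc _ (star _), ← mul_assoc (star _),
      hu, one_mul, mul_assoc]

/-- The perturbation `x ↦ φ x + ⟪Ω, Z (x Ω)⟫` of the state by an operator `Z`. -/
noncomputable def perturbedState (hs : IsState φ) (Z : GNS hs →L[ℂ] GNS hs) : PF d ℕ →ₗ[ℂ] ℂ :=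
  φ + ((innerSL ℂ (gnsVector hs)).toLinearMap ∘ₗ Z.toLinearMap ∘ₗ gnsVec hs)

theorem perturbedState_apply (hs : IsState φ) (Z : GNS hs →L[ℂ] GNS hs) (x : PF d ℕ) :
    perturbedState hs Z x = φ x + ⟪gnsVector hs, Z (gnsVec hs x)⟫_ℂ := rfl

theorem perturbedState_mem {hs : IsState φ} (hφ : φ ∈ braidInvariantStates d)
    {Z : GNS hs →L[ℂ] GNS hs} (hZM : Z ∈ gnsAlgebra hs) (hZc : ∀ x, Commute (gnsRep hs x) Z)
    (hZs : IsSelfAdjoint Z) (hZ1 : ‖Z‖ ≤ 1) (hZ0 : ⟪gnsVector hs, Z (gnsVector hs)⟫_ℂ = 0) :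
    perturbedState hs Z ∈ braidInvariantStates d := by
  refine ⟨⟨?_, fun x => ?_⟩, fun b hb x => ?_⟩
  · rw [perturbedState_apply, hs.map_one, gnsVec_one, hZ0, add_zero]
  · have h1 : ⟪gnsVector hs, Z (gnsVec hs (star x * x))⟫_ℂ =
        ⟪gnsVec hs x, Z (gnsVec hs x)⟫_ℂ := by
      rw [← gnsRep_gnsVec, ← mul_apply_eq_comp, ← (hZc _).eq, mul_apply_eq_comp, map_star,
        ContinuousLinearMap.star_eq_adjoint, ContinuousLinearMap.adjoint_inner_right,
        gnsRep_gnsVector]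
    have h2 : (⟪gnsVec hs x, Z (gnsVec hs x)⟫_ℂ).im = 0 := by
      rw [← Complex.conj_eq_iff_im, inner_conj_symm]
      exact hZs.isSymmetric _ _
    have h3 : ‖⟪gnsVec hs x, Z (gnsVec hs x)⟫_ℂ‖ ≤ ‖gnsVec hs x‖ ^ 2 := by
      refine (norm_inner_le_norm _ _).trans ?_
      rw [sq]
      gcongr
      simpa using Z.le_of_opNorm_le hZ1 (gnsVec hs x)
    have h4 := neg_le_of_abs_le ((Complex.abs_re_le_norm _).trans h3)
    rw [perturbedState_apply, h1, ← norm_gnsVec_sq hs, Complex.le_def]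
    constructor
    · rw [Complex.add_re, Complex.ofReal_re, Complex.zero_re]
      linarith
    · rw [Complex.add_im, Complex.ofReal_im, h2, Complex.zero_im, add_zero]
  · obtain ⟨V, hV, hVi, hVM⟩ := exists_braidIsometry hs hφ hb
    have h1 : V * Z = Z * V := by
      have h2 : gnsRep hs b * star (gnsRep hs (b : PF d ℕ)) = 1 := by
        rw [← map_star, ← map_mul, Unitary.mul_star_self_of_mem b.2, map_one]
      rw [hVM Z hZM, (hZc b).eq, mul_assoc Z, h2, mul_one]
    have h3 : V (gnsVector hs) = gnsVector hs := by
      rw [← gnsVec_one, hV, mul_one, Unitary.mul_star_self_of_mem b.2]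
    rw [perturbedState_apply, perturbedState_apply, hφ.2 b hb, ← hV, ← mul_apply_eq_comp, ← h1,
      mul_apply_eq_comp]
    conv_lhs => rw [← h3]
    rw [hVi]

/-- For an extreme state the self-adjoint central elements with vanishing expectation vanish, since
they yield invariant perturbations of the state in opposite directions. -/
theorem eq_zero_of_central {hs : IsState φ}
    (hφ : φ ∈ Set.extremePoints ℝ (braidInvariantStates d))
    {Z : GNS hs →L[ℂ] GNS hs} (hZM : Z ∈ gnsAlgebra hs) (hZc : ∀ x, Commute (gnsRep hs x) Z)
    (hZs : IsSelfAdjoint Z) (hZ0 : ⟪gnsVector hs, Z (gnsVector hs)⟫_ℂ = 0) : Z = 0 := by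
  have key : ∀ ε : ℝ, |ε| * ‖Z‖ ≤ 1 →
      perturbedState hs ((ε : ℂ) • Z) ∈ braidInvariantStates d := fun ε hε => by
    refine perturbedState_mem hφ.1 ?_ (fun x => (hZc x).smul_right _) ?_ ?_ ?_
    · exact SMulMemClass.smul_mem (s := (gnsAlgebra hs).toStarSubalgebra) _ hZM
    · exact IsSelfAdjoint.smul (by simp [IsSelfAdjoint]) hZs
    · rwa [norm_smul, Complex.norm_real, Real.norm_eq_abs]
    · exact (inner_smul_right _ _ _).trans ((congrArg _ hZ0).trans (mul_zero _))
  set ε : ℝ := (‖Z‖ + 1)⁻¹ with hε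
  have hε0 : 0 < ε := by positivity
  have hε1 : |ε| * ‖Z‖ ≤ 1 := by
    rw [abs_of_pos hε0, hε, inv_mul_le_one₀ (by positivity)]
    linarith
  have h1 := hφ.2 (key ε hε1) (key (-ε) (by rwa [abs_neg])) ⟨1 / 2, 1 / 2, by norm_num, by norm_num,
    by norm_num, by
      ext x
      change ((1 / 2 : ℝ) : ℂ) * perturbedState hs _ x + ((1 / 2 : ℝ) : ℂ) * perturbedState hs _ x
        = φ x
      rw [perturbedState_apply, perturbedState_apply]
      have e : ∀ r : ℂ, ⟪gnsVector hs, (r • Z) (gnsVec hs x)⟫_ℂ =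
        r * ⟪gnsVector hs, Z (gnsVec hs x)⟫_ℂ := fun r => inner_smul_right _ _ _
      rw [e, e]
      push_cast
      ring⟩
  refine eq_zero_of_gnsVector hZc ?_
  refine (denseRange_gnsVec hs).eq_zero_of_inner_left (𝕜 := ℂ) fun x => ?_
  have h2 := congrArg (· x) h1
  simp only [perturbedState_apply] at h2
  have h3 : ⟪gnsVector hs, (((ε : ℂ)) • Z) (gnsVec hs x)⟫_ℂ = 0 := by
    simpa using h2
  have h4 : (ε : ℂ) * ⟪gnsVector hs, Z (gnsVec hs x)⟫_ℂ = 0 :=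
    (inner_smul_right _ _ _).symm.trans h3
  have h5 := (mul_eq_zero.1 h4).resolve_left (by exact_mod_cast hε0.ne')
  rw [← h5]
  exact hZs.isSymmetric _ _

theorem isFactor_of_mem_extremePoints (hs : IsState φ)
    (hφ : φ ∈ Set.extremePoints ℝ (braidInvariantStates d)) : IsFactor (gnsAlgebra hs) := by
  -- self-adjoint central elements are scalars
  have key : ∀ Z ∈ gnsAlgebra hs, (∀ x, Commute (gnsRep hs x) Z) → IsSelfAdjoint Z →
      Z ∈ (⊥ : StarSubalgebra ℂ (GNS hs →L[ℂ] GNS hs)) := by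
    intro Z hZM hZc hZs
    set r := ⟪gnsVector hs, Z (gnsVector hs)⟫_ℂ with hr
    have hr' : star r = r := by
      rw [hr, Complex.star_def, inner_conj_symm]
      exact hZs.isSymmetric _ _
    have h1 : Z - algebraMap ℂ _ r = 0 := by
      refine eq_zero_of_central hφ (sub_mem hZM ?_) (fun x => ?_) (hZs.sub ?_) ?_
      · exact (gnsAlgebra hs).toStarSubalgebra.algebraMap_mem r
      · exact (hZc x).sub_right (Algebra.commutes r _).symm
      · rw [IsSelfAdjoint, ← algebraMap_star_comm, hr']
      · rw [Algebra.algebraMap_eq_smul_one]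
        change ⟪gnsVector hs, Z (gnsVector hs) - r • gnsVector hs⟫_ℂ = 0
        rw [inner_sub_right, inner_smul_right, inner_self_eq_norm_sq_to_K, norm_gnsVector, ← hr]
        simp
    rw [sub_eq_zero] at h1
    rw [h1]
    exact StarSubalgebra.algebraMap_mem _ r
  refine eq_bot_iff.2 fun Z hZ => ?_
  obtain ⟨hZM, hZc'⟩ := hZ
  have hZM : Z ∈ gnsAlgebra hs := hZM
  have hZc := mem_commutant_gnsAlgebra.1 hZc'
  have hZc2 : ∀ x, Commute (gnsRep hs x) (star Z) :=
    mem_commutant_gnsAlgebra.1 (star_mem (s := (gnsAlgebra hs).commutant) hZc')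
  have h1 := key (Z + star Z) (add_mem hZM (star_mem hZM)) (fun x => (hZc x).add_right (hZc2 x))
    (IsSelfAdjoint.add_star_self Z)
  have h2 := key (Complex.I • (Z - star Z))
    (SMulMemClass.smul_mem (s := (gnsAlgebra hs).toStarSubalgebra) _ (sub_mem hZM (star_mem hZM)))
    (fun x => ((hZc x).sub_right (hZc2 x)).smul_right _) (by
      rw [IsSelfAdjoint, star_smul, star_sub, star_star, Complex.star_def, Complex.conj_I, neg_smul,
        ← smul_neg, neg_sub])
  have e : Z = (1 / 2 : ℂ) • ((Z + star Z) - Complex.I • (Complex.I • (Z - star Z))) := by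
    rw [smul_smul, Complex.I_mul_I, neg_one_smul]
    module
  rw [e]
  exact SMulMemClass.smul_mem _ (sub_mem h1 (SMulMemClass.smul_mem _ h2))

end BraidUnitary

/-! ### Braid fixed points for a separating vector -/

section Bicommutant

variable {H : Type*} [NormedAddCommGroup H] [InnerProductSpace ℂ H]

theorem commute_starProjection {K : Submodule ℂ H} [K.HasOrthogonalProjection] {D D' : H →L[ℂ] H}
    (hD : ∀ v w, ⟪D' v, w⟫_ℂ = ⟪v, D w⟫_ℂ) (h : ∀ v ∈ K, D v ∈ K) (h' : ∀ v ∈ K, D' v ∈ K) :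
    Commute D K.starProjection := by
  change D * K.starProjection = K.starProjection * D
  ext v
  obtain ⟨y, hy, z, hz, rfl⟩ := K.exists_add_mem_mem_orthogonal v
  have hz' : D z ∈ Kᗮ := fun k hk => by rw [← hD]; exact hz _ (h' k hk)
  rw [mul_apply_eq_comp, mul_apply_eq_comp, map_add, map_add, map_add, map_add,
    Submodule.starProjection_eq_self_iff.2 hy, Submodule.starProjection_eq_self_iff.2 (h y hy),
    (Submodule.starProjection_apply_eq_zero_iff _).2 hz,
    (Submodule.starProjection_apply_eq_zero_iff _).2 hz', map_zero]

/-- The operator `T ⊕ T` on the Hilbert sum of two copies of the space. -/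
noncomputable def diagOp (T : H →L[ℂ] H) : WithLp 2 (H × H) →L[ℂ] WithLp 2 (H × H) :=
  ((WithLp.prodContinuousLinearEquiv 2 ℂ H H).symm : H × H →L[ℂ] WithLp 2 (H × H)) ∘L
    (T.prodMap T) ∘L ((WithLp.prodContinuousLinearEquiv 2 ℂ H H) : WithLp 2 (H × H) →L[ℂ] H × H)

theorem diagOp_toLp (T : H →L[ℂ] H) (v w : H) :
    diagOp T (WithLp.toLp 2 (v, w)) = WithLp.toLp 2 (T v, T w) := rfl

/-- An operator on `H ⊕ H` commuting with `T ⊕ T` for all `T` in a set also commutes with `X ⊕ X`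
for `X` in the bicommutant: its four blocks lie in the commutant. -/
theorem commute_diagOp {S : Set (H →L[ℂ] H)} {X : H →L[ℂ] H}
    (hX : ∀ Y, (∀ T ∈ S, Commute T Y) → Commute Y X)
    {p : WithLp 2 (H × H) →L[ℂ] WithLp 2 (H × H)} (hp : ∀ T ∈ S, Commute (diagOp T) p) :
    Commute (diagOp X) p := by
  let e : WithLp 2 (H × H) →L[ℂ] H × H := (WithLp.prodContinuousLinearEquiv 2 ℂ H H)
  let f : H × H →L[ℂ] WithLp 2 (H × H) := (WithLp.prodContinuousLinearEquiv 2 ℂ H H).symm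
  let p₁₁ := ContinuousLinearMap.fst ℂ H H ∘L e ∘L p ∘L f ∘L ContinuousLinearMap.inl ℂ H H
  let p₁₂ := ContinuousLinearMap.fst ℂ H H ∘L e ∘L p ∘L f ∘L ContinuousLinearMap.inr ℂ H H
  let p₂₁ := ContinuousLinearMap.snd ℂ H H ∘L e ∘L p ∘L f ∘L ContinuousLinearMap.inl ℂ H H
  let p₂₂ := ContinuousLinearMap.snd ℂ H H ∘L e ∘L p ∘L f ∘L ContinuousLinearMap.inr ℂ H H
  have hp' : ∀ v w, p (WithLp.toLp 2 (v, w)) =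
      WithLp.toLp 2 (p₁₁ v + p₁₂ w, p₂₁ v + p₂₂ w) := by
    intro v w
    have h1 : (WithLp.toLp 2 (v, w) : WithLp 2 (H × H)) =
        WithLp.toLp 2 (v, 0) + WithLp.toLp 2 (0, w) := by
      rw [← WithLp.toLp_add]; simp
    rw [h1, map_add]
    rfl
  have hl : ∀ T ∈ S, ∀ v, p (WithLp.toLp 2 (T v, 0)) = diagOp T (p (WithLp.toLp 2 (v, 0))) := by
    intro T hT v
    rw [← mul_apply_eq_comp, (hp T hT).eq, mul_apply_eq_comp, diagOp_toLp, map_zero]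
  have hr : ∀ T ∈ S, ∀ v, p (WithLp.toLp 2 (0, T v)) = diagOp T (p (WithLp.toLp 2 (0, v))) := by
    intro T hT v
    rw [← mul_apply_eq_comp, (hp T hT).eq, mul_apply_eq_comp, diagOp_toLp, map_zero]
  have h11 : Commute p₁₁ X := hX _ fun T hT => ContinuousLinearMap.ext fun v =>
    (congrArg (fun u : WithLp 2 (H × H) => u.fst) (hl T hT v)).symm
  have h12 : Commute p₁₂ X := hX _ fun T hT => ContinuousLinearMap.ext fun v =>
    (congrArg (fun u : WithLp 2 (H × H) => u.fst) (hr T hT v)).symm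
  have h21 : Commute p₂₁ X := hX _ fun T hT => ContinuousLinearMap.ext fun v =>
    (congrArg (fun u : WithLp 2 (H × H) => u.snd) (hl T hT v)).symm
  have h22 : Commute p₂₂ X := hX _ fun T hT => ContinuousLinearMap.ext fun v =>
    (congrArg (fun u : WithLp 2 (H × H) => u.snd) (hr T hT v)).symm
  have ha : ∀ {q : H →L[ℂ] H}, Commute q X → ∀ v, X (q v) = q (X v) := fun h v =>
    (congrArg (· v) h.eq).symm
  refine ContinuousLinearMap.ext fun u => ?_
  obtain ⟨v, w⟩ := u
  rw [mul_apply_eq_comp, mul_apply_eq_comp, hp', diagOp_toLp, diagOp_toLp, hp', map_add, map_add,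
    ha h11, ha h12, ha h21, ha h22]

/-- A real subspace of a complex Hilbert space contains in its closure all vectors real-orthogonal
to its real-orthogonal complement. -/
theorem mem_closure_of_re_inner [CompleteSpace H] {A : Set H} (h0 : (0 : H) ∈ A)
    (hadd : ∀ v ∈ A, ∀ w ∈ A, v + w ∈ A) (hsmul : ∀ (r : ℝ), ∀ v ∈ A, (r : ℂ) • v ∈ A) {u : H}
    (h : ∀ z, (∀ v ∈ A, (⟪z, v⟫_ℂ).re = 0) → (⟪z, u⟫_ℂ).re = 0) : u ∈ closure A := by
  let _ : InnerProductSpace ℝ H := InnerProductSpace.complexToReal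
  let K : Submodule ℝ H :=
    { carrier := A
      zero_mem' := h0
      add_mem' := fun {v w} hv hw => hadd v hv w hw
      smul_mem' := fun r v hv => hsmul r v hv }
  have hKc : CompleteSpace K.topologicalClosure :=
    (Submodule.isClosed_topologicalClosure _).completeSpace_coe
  obtain ⟨y, hy, z, hz, e⟩ :=
    Submodule.exists_add_mem_mem_orthogonal (𝕜 := ℝ) (K := K.topologicalClosure) u
  have h1 : (⟪z, u⟫_ℂ).re = 0 := h z fun v hv =>
    Submodule.inner_left_of_mem_orthogonal (Submodule.le_topologicalClosure K hv) hz
  have h2 : (⟪z, y⟫_ℂ).re = 0 := Submodule.inner_left_of_mem_orthogonal hy hz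
  rw [e, inner_add_right, Complex.add_re, h2, zero_add] at h1
  have hz0 : z = 0 := inner_self_eq_zero (𝕜 := ℝ).1 h1
  rw [e, hz0, add_zero]
  exact hy

end Bicommutant

section Separating

open Filter Topology

variable {d : ℕ} [NeZero d] {φ : PF d ℕ →ₗ[ℂ] ℂ} {hs : IsState φ}

/-- A sum of two vector functionals vanishing on `π (PF_∞)` vanishes on the von Neumann algebra. -/
theorem inner_add_inner_eq_zero {X : GNS hs →L[ℂ] GNS hs} (hX : X ∈ gnsAlgebra hs)
    {v w v' w' : GNS hs} (h : ∀ x, ⟪v', gnsRep hs x v⟫_ℂ + ⟪w', gnsRep hs x w⟫_ℂ = 0) :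
    ⟪v', X v⟫_ℂ + ⟪w', X w⟫_ℂ = 0 := by
  -- the closure `K` of the vectors `(π x v, π x w)`
  let L : PF d ℕ →ₗ[ℂ] WithLp 2 (GNS hs × GNS hs) :=
    { toFun := fun x => WithLp.toLp 2 (gnsRep hs x v, gnsRep hs x w)
      map_add' := fun x y => by rw [map_add]; rfl
      map_smul' := fun r x => by rw [map_smul]; rfl }
  have hL : ∀ x, L x = WithLp.toLp 2 (gnsRep hs x v, gnsRep hs x w) := fun _ => rfl
  let K := (LinearMap.range L).topologicalClosure
  have hKc : CompleteSpace K := (Submodule.isClosed_topologicalClosure _).completeSpace_coe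
  have hK : ∀ x, ∀ u ∈ K, diagOp (gnsRep hs x) u ∈ K := by
    intro x u hu
    have h1 : Set.MapsTo (diagOp (gnsRep hs x)) (LinearMap.range L : Set _)
        (LinearMap.range L : Set _) := by
      rintro _ ⟨y, rfl⟩
      refine ⟨x * y, ?_⟩
      rw [hL, hL, diagOp_toLp, map_mul]
      rfl
    exact h1.closure (diagOp (gnsRep hs x)).continuous hu
  have hadj : ∀ x (u u' : WithLp 2 (GNS hs × GNS hs)),
      ⟪diagOp (gnsRep hs (star x)) u, u'⟫_ℂ = ⟪u, diagOp (gnsRep hs x) u'⟫_ℂ := by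
    intro x u u'
    obtain ⟨a, b⟩ := u
    obtain ⟨a', b'⟩ := u'
    rw [diagOp_toLp, diagOp_toLp, WithLp.prod_inner_apply, WithLp.prod_inner_apply, map_star,
      ContinuousLinearMap.star_eq_adjoint]
    simp only [ContinuousLinearMap.adjoint_inner_left]
  have hp : ∀ T ∈ Set.range (gnsRep hs), Commute (diagOp T) K.starProjection := by
    rintro _ ⟨x, rfl⟩
    exact commute_starProjection (hadj x) (hK x) (hK (star x))
  have hX' := commute_diagOp
    (fun Y hY => mem_gnsAlgebra.1 hX Y fun x => hY _ (Set.mem_range_self x)) hp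
  have h1 : (WithLp.toLp 2 (v, w) : WithLp 2 (GNS hs × GNS hs)) ∈ K :=
    Submodule.le_topologicalClosure _ ⟨1, by rw [hL, map_one]; rfl⟩
  have h2 : diagOp X (WithLp.toLp 2 (v, w)) ∈ K := by
    rw [← Submodule.starProjection_eq_self_iff.2 h1, ← mul_apply_eq_comp, hX'.eq]
    exact Submodule.starProjection_apply_mem _ _
  have h3 : (WithLp.toLp 2 (v', w') : WithLp 2 (GNS hs × GNS hs)) ∈ Kᗮ := by
    rw [Submodule.orthogonal_closure]
    rintro _ ⟨x, rfl⟩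
    have h4 := congrArg (starRingEnd ℂ) (h x)
    rw [map_add, inner_conj_symm, inner_conj_symm, map_zero] at h4
    rwa [hL, WithLp.prod_inner_apply]
  have h4 := Submodule.inner_left_of_mem_orthogonal h2 h3
  rwa [diagOp_toLp, WithLp.prod_inner_apply] at h4

/-- Self-adjoint elements of the von Neumann algebra can be approximated on `Ω` by self-adjoint
elements of `PF_∞`. -/
theorem exists_seq_isSelfAdjoint {X : GNS hs →L[ℂ] GNS hs} (hX : X ∈ gnsAlgebra hs)
    (hXs : IsSelfAdjoint X) :
    ∃ x : ℕ → PF d ℕ, (∀ n, IsSelfAdjoint (x n)) ∧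
      Tendsto (fun n => gnsVec hs (x n)) atTop (𝓝 (X (gnsVector hs))) := by
  suffices h : X (gnsVector hs) ∈ closure {v | ∃ x, IsSelfAdjoint x ∧ gnsVec hs x = v} by
    obtain ⟨u, hu, hlim⟩ := mem_closure_iff_seq_limit.1 h
    choose x hx hxu using hu
    exact ⟨x, hx, by simpa only [hxu] using hlim⟩
  refine mem_closure_of_re_inner
    (A := {v | ∃ x, IsSelfAdjoint x ∧ gnsVec hs x = v})
    ⟨0, IsSelfAdjoint.zero _, map_zero _⟩ ?_ ?_ fun z hz => ?_
  · rintro _ ⟨x, hx, rfl⟩ _ ⟨y, hy, rfl⟩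
    exact ⟨x + y, hx.add hy, map_add _ _ _⟩
  · rintro r _ ⟨x, hx, rfl⟩
    exact ⟨(r : ℂ) • x, IsSelfAdjoint.smul (by simp [IsSelfAdjoint]) hx, map_smul _ _ _⟩
  have hre : ∀ x, IsSelfAdjoint x → (⟪z, gnsRep hs x (gnsVector hs)⟫_ℂ).re = 0 := fun x hx => by
    rw [gnsRep_gnsVector]
    exact hz _ ⟨x, hx, rfl⟩
  have hsa : ∀ T : GNS hs →L[ℂ] GNS hs, IsSelfAdjoint T →
      ⟪z, T (gnsVector hs)⟫_ℂ + ⟪gnsVector hs, T z⟫_ℂ =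
        ((2 * (⟪z, T (gnsVector hs)⟫_ℂ).re : ℝ) : ℂ) := by
    intro T hT
    have h1 : ⟪gnsVector hs, T z⟫_ℂ = star ⟪z, T (gnsVector hs)⟫_ℂ := by
      rw [Complex.star_def, inner_conj_symm]
      exact (hT.isSymmetric _ _).symm
    rw [h1, Complex.star_def, Complex.add_conj]
  have h0 : ∀ x, ⟪z, gnsRep hs x (gnsVector hs)⟫_ℂ + ⟪gnsVector hs, gnsRep hs x z⟫_ℂ = 0 := by
    have h1 : ∀ x, IsSelfAdjoint x →
        ⟪z, gnsRep hs x (gnsVector hs)⟫_ℂ + ⟪gnsVector hs, gnsRep hs x z⟫_ℂ = 0 := fun x hx => by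
      rw [hsa _ (hx.map (gnsRep hs)), hre x hx, mul_zero, Complex.ofReal_zero]
    intro x
    have h2 := h1 (x + star x) (IsSelfAdjoint.add_star_self x)
    have h3 := h1 (Complex.I • (x - star x)) (by
      rw [IsSelfAdjoint, star_smul, star_sub, star_star, Complex.star_def, Complex.conj_I, neg_smul,
        ← smul_neg, neg_sub])
    have e1 : x = (1 / 2 : ℂ) • ((x + star x) - Complex.I • (Complex.I • (x - star x))) := by
      rw [smul_smul, Complex.I_mul_I, neg_one_smul]
      module
    have e2 : ∀ u u' : GNS hs, ⟪u, gnsRep hs x u'⟫_ℂ =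
        (1 / 2) * (⟪u, gnsRep hs (x + star x) u'⟫_ℂ -
          Complex.I * ⟪u, gnsRep hs (Complex.I • (x - star x)) u'⟫_ℂ) := by
      intro u u'
      conv_lhs => rw [e1]
      rw [map_smul, map_sub, map_smul _ Complex.I]
      change ⟪u, (1 / 2 : ℂ) • (gnsRep hs (x + star x) u' -
        Complex.I • gnsRep hs (Complex.I • (x - star x)) u')⟫_ℂ = _
      rw [inner_smul_right, inner_sub_right, inner_smul_right]
    rw [e2, e2]
    linear_combination (1 / 2) * h2 - (1 / 2) * Complex.I * h3
  have h1 := inner_add_inner_eq_zero hX h0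
  rw [hsa X hXs] at h1
  have h2 : 2 * (⟪z, X (gnsVector hs)⟫_ℂ).re = 0 := by exact_mod_cast h1
  linarith

/-- If `Ω` is separating for the von Neumann algebra, it is cyclic for the commutant. -/
theorem dense_commutant_gnsVector (h : IsSeparating hs) :
    Dense {v | ∃ Y : GNS hs →L[ℂ] GNS hs, (∀ x, Commute (gnsRep hs x) Y) ∧
      Y (gnsVector hs) = v} := by
  let K : Submodule ℂ (GNS hs) :=
    { carrier := {v | ∃ Y : GNS hs →L[ℂ] GNS hs, (∀ x, Commute (gnsRep hs x) Y) ∧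
        Y (gnsVector hs) = v}
      zero_mem' := ⟨0, fun _ => Commute.zero_right _, rfl⟩
      add_mem' := by
        rintro _ _ ⟨Y, hY, rfl⟩ ⟨Z, hZ, rfl⟩
        exact ⟨Y + Z, fun x => (hY x).add_right (hZ x), rfl⟩
      smul_mem' := by
        rintro r _ ⟨Y, hY, rfl⟩
        exact ⟨r • Y, fun x => (hY x).smul_right r, rfl⟩ }
  have hKc : CompleteSpace K.topologicalClosure :=
    (Submodule.isClosed_topologicalClosure _).completeSpace_coe
  have hK : ∀ Y : GNS hs →L[ℂ] GNS hs, (∀ x, Commute (gnsRep hs x) Y) →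
      ∀ v ∈ K.topologicalClosure, Y v ∈ K.topologicalClosure := by
    intro Y hY v hv
    have h1 : Set.MapsTo Y (K : Set (GNS hs)) (K : Set (GNS hs)) := by
      rintro _ ⟨Z, hZ, rfl⟩
      exact ⟨Y * Z, fun x => (hY x).mul_right (hZ x), rfl⟩
    exact h1.closure Y.continuous hv
  have hp : K.topologicalClosure.starProjection ∈ gnsAlgebra hs := by
    refine mem_gnsAlgebra.2 fun Y hY => ?_
    refine commute_starProjection (D' := star Y) (fun v w => ?_) (hK Y hY) (hK _ fun x => ?_)
    · rw [ContinuousLinearMap.star_eq_adjoint, ContinuousLinearMap.adjoint_inner_left]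
    · have h2 := congrArg star (hY (star x)).eq
      rw [star_mul, star_mul, map_star, star_star] at h2
      exact h2.symm
  have h1 : (1 - K.topologicalClosure.starProjection : GNS hs →L[ℂ] GNS hs) = 0 := by
    refine h _ (sub_mem (one_mem _) hp) ?_
    change gnsVector hs - K.topologicalClosure.starProjection (gnsVector hs) = 0
    rw [sub_eq_zero, eq_comm, Submodule.starProjection_eq_self_iff]
    exact Submodule.le_topologicalClosure _ ⟨1, fun _ => Commute.one_right _, rfl⟩
  intro v
  have h2 : v = K.topologicalClosure.starProjection v :=
    congrArg (fun T : GNS hs →L[ℂ] GNS hs => T v) (sub_eq_zero.1 h1)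
  rw [h2]
  exact Submodule.starProjection_apply_mem K.topologicalClosure v

/-- The self-adjoint braid fixed points lie in the tail if `Ω` is separating: approximate `X Ω` by
`x Ω` with `x` self-adjoint, and replace `x` by its shifts, which are braid conjugates of `x` and
approximate `X Ω` as well. On the dense set of the vectors `Y Ω`, `Y` in the commutant, this
determines the matrix elements of products of `X` with operators commuting with the shifts. -/
theorem mem_tailAlgebra_of_isSelfAdjoint (hφ : φ ∈ braidInvariantStates d)
    (h : IsSeparating hs) {X : GNS hs →L[ℂ] GNS hs} (hX : X ∈ braidFixedPoints hs)
    (hXs : IsSelfAdjoint X) : X ∈ tailAlgebra hs := by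
  obtain ⟨x, hxs, hx⟩ := exists_seq_isSelfAdjoint hX.1 hXs
  refine mem_tailAlgebra.2 fun n S hS => ?_
  have hz : Tendsto (fun k => gnsVec hs (shift n (x k))) atTop (𝓝 (X (gnsVector hs))) := by
    rw [tendsto_iff_norm_sub_tendsto_zero] at hx ⊢
    refine hx.congr fun k => ?_
    obtain ⟨b, hb, e⟩ := exists_braid_eq_shift n (x k)
    obtain ⟨V, hV, hVi, hVM⟩ := exists_braidIsometry hs hφ hb
    have h1 : V (gnsVector hs) = gnsVector hs := by
      rw [← gnsVec_one, hV, mul_one, Unitary.mul_star_self_of_mem b.2]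
    have h2 : V (X (gnsVector hs)) = X (gnsVector hs) := by
      rw [← mul_apply_eq_comp, hVM X hX.1, hX.2 b hb, mul_apply_eq_comp, h1]
    rw [← e, ← hV]
    conv_rhs => rw [← h2]
    rw [← map_sub]
    exact (LinearIsometry.norm_map (⟨V.toLinearMap, fun v => by
      rw [@norm_eq_sqrt_re_inner ℂ, @norm_eq_sqrt_re_inner ℂ _ _ _ _ v]
      exact congrArg _ (congrArg _ (hVi v v))⟩ : GNS hs →ₗᵢ[ℂ] GNS hs) _).symm
  -- `X` and the shifts of `x k` act on `Y Ω` through their action on `Ω`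
  have hXY : ∀ Y : GNS hs →L[ℂ] GNS hs, (∀ x, Commute (gnsRep hs x) Y) →
      Tendsto (fun k => gnsRep hs (shift n (x k)) (Y (gnsVector hs))) atTop
        (𝓝 (X (Y (gnsVector hs)))) := by
    intro Y hY
    have h1 : X (Y (gnsVector hs)) = Y (X (gnsVector hs)) := by
      rw [← mul_apply_eq_comp, ← mul_apply_eq_comp, (mem_gnsAlgebra.1 hX.1 Y hY).eq]
    rw [h1]
    refine ((Y.continuous.tendsto _).comp hz).congr fun k => ?_
    rw [Function.comp_apply, ← gnsRep_gnsVector, ← mul_apply_eq_comp, ← mul_apply_eq_comp,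
      (hY _).eq]
  have hd := dense_commutant_gnsVector h
  have key : ∀ Y Y' : GNS hs →L[ℂ] GNS hs, (∀ x, Commute (gnsRep hs x) Y) →
      (∀ x, Commute (gnsRep hs x) Y') →
      ⟪Y' (gnsVector hs), S (X (Y (gnsVector hs)))⟫_ℂ =
        ⟪Y' (gnsVector hs), X (S (Y (gnsVector hs)))⟫_ℂ := by
    intro Y Y' hY hY'
    have h1 : Tendsto (fun k => ⟪Y' (gnsVector hs),
        S (gnsRep hs (shift n (x k)) (Y (gnsVector hs)))⟫_ℂ) atTop
        (𝓝 ⟪Y' (gnsVector hs), S (X (Y (gnsVector hs)))⟫_ℂ) :=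
      tendsto_const_nhds.inner ((S.continuous.tendsto _).comp (hXY Y hY))
    have h2 : Tendsto (fun k => ⟪gnsRep hs (shift n (x k)) (Y' (gnsVector hs)),
        S (Y (gnsVector hs))⟫_ℂ) atTop
        (𝓝 ⟪X (Y' (gnsVector hs)), S (Y (gnsVector hs))⟫_ℂ) :=
      (hXY Y' hY').inner tendsto_const_nhds
    refine (tendsto_nhds_unique h1 (h2.congr fun k => ?_)).trans (hXs.isSymmetric _ _)
    have h3 : IsSelfAdjoint (gnsRep hs (shift n (x k))) :=
      ((hxs k).map (shift n)).map (gnsRep hs)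
    rw [← mul_apply_eq_comp S (gnsRep hs _), ← (hS _).eq]
    exact h3.isSymmetric _ _
  refine DFunLike.coe_injective (Continuous.ext_on hd (S * X).continuous (X * S).continuous ?_)
  rintro _ ⟨Y, hY, rfl⟩
  refine hd.eq_of_inner_right (𝕜 := ℂ) ?_
  rintro _ ⟨Y', hY', rfl⟩
  exact key Y Y' hY hY'

theorem braidFixedPoints_subset_tailAlgebra (hφ : φ ∈ braidInvariantStates d)
    (h : IsSeparating hs) :
    braidFixedPoints hs ⊆ (tailAlgebra hs : Set (GNS hs →L[ℂ] GNS hs)) := by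
  intro X hX
  have hX' : star X ∈ braidFixedPoints hs := by
    refine ⟨star_mem hX.1, fun b hb => ?_⟩
    have h1 := congrArg star (hX.2 b hb)
    rwa [star_mul, star_mul, star_star, ← mul_assoc] at h1
  have hadd : ∀ Y ∈ braidFixedPoints hs, ∀ Z ∈ braidFixedPoints hs,
      Y + Z ∈ braidFixedPoints hs := fun Y hY Z hZ => ⟨add_mem hY.1 hZ.1, fun b hb => by
    rw [mul_add, add_mul, hY.2 b hb, hZ.2 b hb]⟩
  have hsmul : ∀ r : ℂ, ∀ Y ∈ braidFixedPoints hs, r • Y ∈ braidFixedPoints hs :=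
    fun r Y hY => ⟨SMulMemClass.smul_mem (s := (gnsAlgebra hs).toStarSubalgebra) r hY.1,
      fun b hb => by rw [mul_smul_comm, smul_mul_assoc, hY.2 b hb]⟩
  have h1 := mem_tailAlgebra_of_isSelfAdjoint hφ h (hadd X hX _ hX')
    (IsSelfAdjoint.add_star_self X)
  have h2 := mem_tailAlgebra_of_isSelfAdjoint hφ h
    (hsmul Complex.I _ (hadd X hX _ (hsmul (-1) _ hX'))) (by
      rw [IsSelfAdjoint, neg_one_smul, ← sub_eq_add_neg, star_smul, star_sub, star_star,
        Complex.star_def, Complex.conj_I, neg_smul, ← smul_neg, neg_sub])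
  have e : X = (1 / 2 : ℂ) • ((X + star X) -
      Complex.I • (Complex.I • (X + (-1 : ℂ) • star X))) := by
    rw [smul_smul, Complex.I_mul_I, neg_one_smul]
    module
  change X ∈ tailAlgebra hs
  rw [e]
  exact SMulMemClass.smul_mem _ (sub_mem h1 (SMulMemClass.smul_mem _ h2))

end Separating

/-! ### The equivalences -/

theorem mainTheorem2 (d : ℕ) [NeZero d] (hd : Squarefree d) (φ : PF d ℕ →ₗ[ℂ] ℂ)
    (hφ : φ ∈ braidInvariantStates d) :
    List.TFAE
      [φ ∈ Set.extremePoints ℝ (braidInvariantStates d),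
        ∃ ρ : PF d (Fin 2) →ₗ[ℂ] ℂ, IsState ρ ∧ IsNeutral ρ ∧ IsInfiniteProduct φ ρ,
        neutralTailAlgebra hφ.1 = ⊥,
        tailAlgebra hφ.1 = ⊥,
        IsFactor (gnsAlgebra hφ.1)] ∧
    (tailAlgebra hφ.1 : Set (GNS hφ.1 →L[ℂ] GNS hφ.1)) ⊆ braidFixedPoints hφ.1 ∧
    (IsSeparating hφ.1 →
      (tailAlgebra hφ.1 : Set (GNS hφ.1 →L[ℂ] GNS hφ.1)) = braidFixedPoints hφ.1) := by
  have hcentral : ∀ X ∈ tailAlgebra hφ.1, ∀ x, Commute (gnsRep hφ.1 x) X := fun X hX x =>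
    commute_of_mem_tailAlgebra hd (fun a => braidInvariantStates.map_mono_eq_zero hd hφ) hX x
  have hsub : (tailAlgebra hφ.1 : Set (GNS hφ.1 →L[ℂ] GNS hφ.1)) ⊆ braidFixedPoints hφ.1 := by
    refine fun X hX => ⟨tailAlgebra_le_gnsAlgebra hX, fun b _ => ?_⟩
    rw [(hcentral X hX _).eq, mul_assoc, ← map_star, ← map_mul, Unitary.mul_star_self_of_mem b.2,
      map_one, mul_one]
  refine ⟨?_, hsub, fun h => hsub.antisymm (braidFixedPoints_subset_tailAlgebra hφ h)⟩
  tfae_have 1 → 5 := isFactor_of_mem_extremePoints hφ.1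
  tfae_have 5 → 4 := fun h => eq_bot_iff.2 fun X hX => by
    rw [← show _ = ⊥ from h]
    exact ⟨tailAlgebra_le_gnsAlgebra hX, mem_commutant_gnsAlgebra.2 (hcentral X hX)⟩
  tfae_have 4 → 3 := fun h => eq_bot_iff.2 (h ▸ inf_le_left)
  tfae_have 3 → 2 := fun h => isInfiniteProduct_of_isClustering hd hφ
    (isClustering_of_neutralTailAlgebra_eq_bot hd hφ.1 hφ h)
  tfae_have 2 → 1 := fun ⟨_, _, _, h⟩ =>
    mem_extremePoints_of_isClustering hφ (isClustering_of_isInfiniteProduct h)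
  tfae_finish
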